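/- A *metric graph* $(\Gamma,\mathcal L)$ is a finite graph $\Gamma$ (loops and multiple edges allowed, a loop counting twice in the degree of its vertex) with a positive length assigned to each non-oriented edge; its *volume* is the sum of these lengths. For $\Gamma$ connected, $p$ a vertex, $X=\widetilde\Gamma$ the universal cover with the lifted metric $d$, and $x_0\in X$ a lift of $p$, the *volume entropy* is $$h(\mathcal L)=\limsup_{R\to\infty}\frac1R\log\#\{g\in\pi_1(\Gamma,p): d(x_0,gx_0)\le R\}.$$ Let $\mathcal M_k$ denote the set of finite connected volume-one metric graphs (up to isometry) without vertices of degree $1$ or $2$ whose fundamental group is free of rank $k$; for $k\ge2$ this is the moduli space $CV(F_k)/Out(F_k)$. **Theorem.** (1) Let $k\ge 1$ and let $(\Gamma,\mathcal L)\in\mathcal M_k$ be such that $h(\mathcal L)=(3k-3)\log 2$, where $h$ is computed from any vertex $p$ of $\Gamma$. Then $\Gamma$ is trivalent (every vertex has degree $3$) and all edges of $\Gamma$ have equal lengths in $\mathcal L$. (2) Consequently, for every $k\ge 2$, the minimum of $h$ over $\mathcal M_k$ exists and equals $(3k-3)\log 2$, and $(\Gamma,\mathcal L)\in\mathcal M_k$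 realizes this minimum if and only if $\Gamma$ is trivalent and all its edges have equal lengths. -/

import Mathlib

open CategoryTheory

/-- A finite metric graph (loops and multiple edges allowed). The underlying graph is given by a
finite vertex set and, for every ordered pair `(a, b)` of vertices, a finite set `a ⟶ b` of
non-oriented edges, each listed exactly once, with an arbitrarily chosen reference orientation
from `a` to `b`. The oriented edges are the arrows of `Quiver.Symmetrify V`: every `e : a ⟶ b`
gives one oriented edge from `a` to `b` and its inverse from `b` to `a`. -/
structure MetricGraph where
  V : Type
  [fintypeV : Fintype V]
  [quiver : Quiver.{0} V]
  [fintypeEdge : ∀ a b : V, Fintype (a ⟶ b)]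
  /-- the length of a non-oriented edge -/
  len : ∀ {a b : V}, (a ⟶ b) → ℝ
  len_pos : ∀ {a b : V} (e : a ⟶ b), 0 < len e

namespace MetricGraph

attribute [instance] MetricGraph.fintypeV MetricGraph.quiver MetricGraph.fintypeEdge

/-- The graph is non-empty and any two vertices are joined by an edge-path, in which edges may be
traversed in both directions. -/
def IsConnected (Γ : MetricGraph) : Prop :=
  Nonempty Γ.V ∧ ∀ a b : Quiver.Symmetrify Γ.V, Nonempty (Quiver.Path a b)

/-- The degree of a vertex; a loop counts twice. -/
def degree (Γ : MetricGraph) (v : Γ.V) : ℕ :=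
  (∑ w : Γ.V, Fintype.card (v ⟶ w)) + ∑ w : Γ.V, Fintype.card (w ⟶ v)

/-- The sum of the lengths of all non-oriented edges. -/
noncomputable def volume (Γ : MetricGraph) : ℝ :=
  ∑ a : Γ.V, ∑ b : Γ.V, ∑ e : a ⟶ b, Γ.len e

/-- The length of an oriented edge; an edge and its inverse have the same length. -/
def orientedLen (Γ : MetricGraph) {a b : Quiver.Symmetrify Γ.V} (e : a ⟶ b) : ℝ :=
  Sum.elim (fun f => Γ.len f) (fun f => Γ.len f) e

/-- The length of an edge-path. -/
def pathLen (Γ : MetricGraph) {a : Quiver.Symmetrify Γ.V} :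
    ∀ {b : Quiver.Symmetrify Γ.V}, Quiver.Path a b → ℝ
  | _, .nil => 0
  | _, .cons γ e => pathLen Γ γ + orientedLen Γ e

/-- The vertex `p` as an object of the fundamental groupoid of the graph. The latter is Mathlib's
`Quiver.FreeGroupoid`: its morphisms are the edge-paths up to insertion and deletion of
back-trackings `e e⁻¹`. -/
def base (Γ : MetricGraph) (p : Γ.V) : Quiver.FreeGroupoid Γ.V :=
  (Quiver.FreeGroupoid.of Γ.V).obj p

/-- The fundamental group `π₁(Γ, p)`. -/
abbrev FundGroup (Γ : MetricGraph) (p : Γ.V) : Type :=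
  CategoryTheory.End (Γ.base p)

/-- The element of the fundamental group that is represented by a closed edge-path at `p`. -/
def homotopyClass (Γ : MetricGraph) (p : Γ.V)
    (γ : Quiver.Path (V := Quiver.Symmetrify Γ.V) p p) : Γ.FundGroup p :=
  (CategoryTheory.Quotient.functor (Quiver.FreeGroupoid.redStep (V := Γ.V))).map
    (X := (p : Quiver.Symmetrify Γ.V)) (Y := (p : Quiver.Symmetrify Γ.V)) γ

/-- The distance `d(x₀, g x₀)` in the universal cover of the metric graph, where `x₀` is a lift of
`p` and `g ∈ π₁(Γ, p)` acts as a deck transformation: the edge-paths from `x₀` to `g x₀` are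
exactly the lifts of the closed edge-paths at `p` that represent `g`. -/
noncomputable def displacement (Γ : MetricGraph) (p : Γ.V) (g : Γ.FundGroup p) : ℝ :=
  sInf {r : ℝ | ∃ γ : Quiver.Path (V := Quiver.Symmetrify Γ.V) p p,
    Γ.homotopyClass p γ = g ∧ Γ.pathLen γ = r}

/-- The volume entropy: the exponential growth rate, as `R → ∞`, of the number of points of the
`π₁(Γ, p)`-orbit of `x₀` in the ball of radius `R` around `x₀` in the universal cover. -/
noncomputable def volumeEntropy (Γ : MetricGraph) (p : Γ.V) : ℝ :=
  Filter.limsup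
    (fun R : ℝ => Real.log (Nat.card {g : Γ.FundGroup p // Γ.displacement p g ≤ R}) / R)
    Filter.atTop

/-- The metric graphs that represent the points of the moduli space `CV(F_k) / Out(F_k)`: finite
connected volume-one metric graphs without vertices of degree one or two whose fundamental group
is free of rank `k`. -/
structure InModuli (Γ : MetricGraph) (k : ℕ) : Prop where
  connected : Γ.IsConnected
  degree_ne_one : ∀ v, Γ.degree v ≠ 1
  degree_ne_two : ∀ v, Γ.degree v ≠ 2
  rank : ∀ p : Γ.V, Nonempty (Γ.FundGroup p ≃* FreeGroup (Fin k))
  volume_eq_one : Γ.volume = 1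

def IsTrivalent (Γ : MetricGraph) : Prop :=
  ∀ v, Γ.degree v = 3

/-- All edges have equal lengths. -/
def IsEquilateral (Γ : MetricGraph) : Prop :=
  ∀ (a b c d : Γ.V) (e : a ⟶ b) (f : c ⟶ d), Γ.len e = Γ.len f

end MetricGraph

/-!
Write `h` for the volume entropy, `d v` for the degree of a vertex `v`, and call an oriented edge a
dart. Reduction of edge-paths identifies `π₁(Γ, p)` with the closed edge-paths at `p` without
backtracking, and the displacement of an element with the length of its reduced edge-path
(`MetricGraph.displacement_eq_wordLen`; uniqueness of reduced edge-paths comes from uniqueness of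
reduced words in the free group on the edges). So `h` is the growth rate of the number of closed
non-backtracking walks.

The lower bound is `∑ d v * log (d v - 1) ≤ 2 * h * volume`
(`MetricGraph.sum_degree_mul_log_le`). For `s > h` the series `X e = ∑ exp (-s * length)` over the
non-backtracking walks that can follow a dart `e` converges: the Poincaré series of the orbit does,
and any walk can be completed to a closed one because the non-backtracking walk is irreducible when
all degrees are at least three (`DartGraph.reflTransGen_step`). Letting `s` tend to `h` and
normalising, a limit point of these vectors is a vector `x > 0` with
`∑ exp (-h * ℓ f) * x f ≤ x e` for every `e`, the sum being over the successors `f` of `e`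
(`exists_pos_supersolution`). Concavity of the logarithm and invariance of the counting measure
under the uniform non-backtracking walk turn this into the bound
(`DartGraph.entropy_inequality`); in the case of equality, `exp (-h * ℓ f) * x f` is constant on the
successors of each dart.

The rank is tied to the degrees by `k - 1 = |E| - |V|` (`MetricGraph.card_edge_add_one`), that is,
`∑ (d v - 2) = 2 * k - 2`. As `d * log (d - 1) ≥ 3 * (d - 2) * log 2` with equality only for `d = 3`
(`three_mul_log_two_le`), the lower bound yields `h ≥ (3 * k - 3) * log 2`, and equality forces the
graph to be trivalent. The case of equality for `x` then gives `exp (-h * ℓ e) = 1 / 2` for every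
edge, so all lengths agree.

Conversely, every dart of a trivalent graph has two successors, which bounds the number of walks
from above when all lengths are equal (`MetricGraph.InModuli.volumeEntropy_eq`). A cyclic chain of
double edges (`MetricGraph.necklace`) shows that such graphs exist in every rank `k ≥ 2`.
-/

/-! ### Words in a finite set of letters with prescribed successors -/

section Words

variable {D : Type*}

/-- The total length of a word whose letters have lengths. -/
def wordLen (ℓ : D → ℝ) (w : List D) : ℝ := (w.map ℓ).sum

@[simp] theorem wordLen_nil (ℓ : D → ℝ) : wordLen ℓ [] = 0 := rfl

@[simp] theorem wordLen_cons (ℓ : D → ℝ) (e : D) (w : List D) :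
    wordLen ℓ (e :: w) = ℓ e + wordLen ℓ w := by simp [wordLen]

@[simp] theorem wordLen_append (ℓ : D → ℝ) (v w : List D) :
    wordLen ℓ (v ++ w) = wordLen ℓ v + wordLen ℓ w := by simp [wordLen]

theorem wordLen_nonneg {ℓ : D → ℝ} (hℓ : ∀ e, 0 < ℓ e) (w : List D) : 0 ≤ wordLen ℓ w :=
  List.sum_nonneg (by simpa using fun e _ => (hℓ e).le)


open Classical in
/-- If the weights `exp (-s * ℓ f)` of the possible successors of any letter add up to at most
`θ < 1`, then at most `(1 - θ)⁻¹ * exp (s * R)` words of length at most `R` can follow a given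
letter. The bound `n * m` on `R` only serves the induction on `n`. -/
theorem exists_finset_words_card_le [Fintype D] (r : D → D → Prop) (ℓ : D → ℝ) {m s θ : ℝ}
    (hm : 0 < m) (hs : 0 ≤ s)
    (hℓ : ∀ e, m ≤ ℓ e) (hθ : θ < 1)
    (h : ∀ e, ∑ f with r e f, Real.exp (-s * ℓ f) ≤ θ) (n : ℕ) :
    ∀ R : ℝ, R < n * m → ∀ e : D, ∃ F : Finset (List D),
      (∀ w, List.IsChain r (e :: w) → wordLen ℓ w ≤ R → w ∈ F) ∧
      (F.card : ℝ) ≤ (1 - θ)⁻¹ * Real.exp (s * R) := by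
  have hpos : ∀ e, 0 < ℓ e := fun e => hm.trans_le (hℓ e)
  have hθ' : 0 < 1 - θ := by linarith
  have hneg : ∀ R : ℝ, R < 0 → ∀ e : D, ∃ F : Finset (List D),
      (∀ w, List.IsChain r (e :: w) → wordLen ℓ w ≤ R → w ∈ F) ∧
      (F.card : ℝ) ≤ (1 - θ)⁻¹ * Real.exp (s * R) := by
    intro R hR e
    refine ⟨∅, fun w _ hw => ?_, by simpa using by positivity⟩
    linarith [wordLen_nonneg hpos w]
  induction n with
  | zero =>
    intro R hR e
    exact hneg R (by simpa using hR) e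
  | succ n ih =>
    intro R hR e
    rcases lt_or_ge R 0 with h0 | h0
    · exact hneg R h0 e
    have key : ∀ f, R - ℓ f < n * m := by
      intro f
      have := hℓ f
      push_cast at hR
      linarith
    choose F hF hcard using fun f => ih (R - ℓ f) (key f) f
    refine ⟨insert [] ((Finset.univ.filter (r e)).biUnion fun f : D => (F f).image (List.cons f)),
      ?_, ?_⟩
    · rintro (_ | ⟨f, w⟩) hw hR'
      · simp
      · rw [List.isChain_cons_cons] at hw
        refine Finset.mem_insert_of_mem (Finset.mem_biUnion.2 ⟨f, by simpa using hw.1, ?_⟩)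
        refine Finset.mem_image_of_mem _ (hF f w hw.2 ?_)
        rw [wordLen_cons] at hR'
        linarith
    · have h1 : ((insert [] ((Finset.univ.filter (r e)).biUnion fun f : D =>
          (F f).image (List.cons f)) : Finset (List D)).card : ℝ) ≤
          (∑ f with r e f, ((F f).card : ℝ)) + 1 := by
        refine (Nat.cast_le.2 (Finset.card_insert_le [] _)).trans ?_
        push_cast
        gcongr
        refine (Nat.cast_le.2 Finset.card_biUnion_le).trans ?_
        push_cast
        exact Finset.sum_le_sum fun f _ => Nat.cast_le.2 Finset.card_image_le
      have h2 : ∑ f with r e f, ((F f).card : ℝ) ≤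
          ((1 - θ)⁻¹ * Real.exp (s * R)) * θ := by
        calc ∑ f with r e f, ((F f).card : ℝ)
            ≤ ∑ f with r e f, ((1 - θ)⁻¹ * Real.exp (s * R)) * Real.exp (-s * ℓ f) := by
              gcongr with f _
              refine (hcard f).trans (le_of_eq ?_)
              rw [mul_assoc, ← Real.exp_add]
              ring_nf
          _ ≤ _ := by
              rw [← Finset.mul_sum]
              gcongr
              exact h e
      have h3 : 1 ≤ Real.exp (s * R) := by
        exact Real.one_le_exp (by positivity)
      have h4 : (1 - θ)⁻¹ * Real.exp (s * R) - ((1 - θ)⁻¹ * Real.exp (s * R)) * θ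
          = Real.exp (s * R) := by field_simp
      linarith


open ENNReal

/-- If the number of points of norm at most `R` grows slower than `exp (s * R)`, then the
Dirichlet series with exponent `s` converges. -/
theorem tsum_exp_lt_top {ι : Type*} (len : ι → ℝ) (hlen : ∀ i, 0 ≤ len i)
    (hfin : ∀ R, {i | len i ≤ R}.Finite) {C s t : ℝ} (hs : 0 ≤ s) (hts : t < s)
    (hC : ∀ n : ℕ, (Nat.card {i // len i ≤ n} : ℝ) ≤ C * Real.exp (t * n)) :
    ∑' i, ENNReal.ofReal (Real.exp (-s * len i)) < ⊤ := by
  have hC0 : 0 ≤ C := by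
    have := (Nat.cast_nonneg _).trans (hC 0)
    simpa using this
  calc ∑' i, ENNReal.ofReal (Real.exp (-s * len i))
      ≤ ∑' i, ∑' n : ℕ, {i | len i ≤ n}.indicator
          (fun _ => ENNReal.ofReal (Real.exp (-s * (n - 1)))) i := by
        gcongr with i
        refine le_trans ?_ (ENNReal.le_tsum ⌈len i⌉₊)
        rw [Set.indicator_of_mem (by exact Nat.le_ceil (len i))]
        refine ENNReal.ofReal_le_ofReal (Real.exp_le_exp.2 ?_)
        have := Nat.ceil_lt_add_one (hlen i)
        nlinarith
    _ = ∑' n : ℕ, ∑' i, {i | len i ≤ n}.indicator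
          (fun _ => ENNReal.ofReal (Real.exp (-s * (n - 1)))) i := ENNReal.tsum_comm
    _ ≤ ∑' n : ℕ, ENNReal.ofReal (C * Real.exp s) * ENNReal.ofReal (Real.exp (t - s)) ^ n := by
        gcongr with n
        have : Finite {i | len i ≤ (n : ℝ)} := hfin n
        rw [← tsum_subtype, ENNReal.tsum_const, ENat.card_eq_coe_natCard,
          ← ENNReal.ofReal_pow (Real.exp_pos _).le, ← ENNReal.ofReal_mul (by positivity),
          ENat.toENNReal_coe, ← ENNReal.ofReal_natCast, ← ENNReal.ofReal_mul (by positivity)]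
        refine ENNReal.ofReal_le_ofReal ?_
        calc (Nat.card {i | len i ≤ (n : ℝ)} : ℝ) * Real.exp (-s * (n - 1))
            ≤ C * Real.exp (t * n) * Real.exp (-s * (n - 1)) := by gcongr; exact hC n
          _ = C * Real.exp s * Real.exp (t - s) ^ n := by
            rw [mul_assoc, mul_assoc, ← Real.exp_nat_mul, ← Real.exp_add, ← Real.exp_add]
            ring_nf
    _ < ⊤ := by
        rw [ENNReal.tsum_mul_left]
        refine ENNReal.mul_lt_top ENNReal.ofReal_lt_top ?_
        rw [ENNReal.tsum_geometric, ENNReal.inv_lt_top, tsub_pos_iff_lt, ENNReal.ofReal_lt_one]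
        exact Real.exp_lt_one_iff.2 (by linarith)

/-- The words that may follow the letter `e`. -/
abbrev WordsAfter (r : D → D → Prop) (e : D) : Type _ := {w : List D // List.IsChain r (e :: w)}

/-- The words that begin with a letter in `A` and end with a letter in `B`. -/
abbrev WordsBetween (r : D → D → Prop) (A B : D → Prop) : Type _ :=
  {w : List D // List.IsChain r w ∧ (∃ x ∈ w.head?, A x) ∧ ∃ x ∈ w.getLast?, B x}

/-- The Dirichlet series of all words that may follow the letter `e`. -/
noncomputable def wordSeries (r : D → D → Prop) (ℓ : D → ℝ) (s : ℝ) (e : D) : ℝ≥0∞ :=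
  ∑' w : WordsAfter r e, ENNReal.ofReal (Real.exp (-s * wordLen ℓ w.1))

theorem one_le_wordSeries (r : D → D → Prop) (ℓ : D → ℝ) (s : ℝ) (e : D) :
    1 ≤ wordSeries r ℓ s e := by
  refine le_trans ?_ (ENNReal.le_tsum (⟨[], by simp⟩ : WordsAfter r e))
  simp

open Classical in
/-- Sorting the non-empty words by their first letter. The neglected empty word would turn this
into an equality with an additional summand `1`. -/
theorem sum_wordSeries_le [Fintype D] (r : D → D → Prop) (ℓ : D → ℝ) (s : ℝ) (e : D) :
    ∑ f with r e f, ENNReal.ofReal (Real.exp (-s * ℓ f)) * wordSeries r ℓ s f ≤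
      wordSeries r ℓ s e := by
  -- Prefixing the first letter embeds the words after the successors of `e` in those after `e`.
  let j : (Σ f : {f // r e f}, WordsAfter r f.1) → WordsAfter r e :=
    fun x => ⟨x.1.1 :: x.2.1, List.isChain_cons_cons.2 ⟨x.1.2, x.2.2⟩⟩
  have hj : Function.Injective j := by
    rintro ⟨⟨f, hf⟩, ⟨w, hw⟩⟩ ⟨⟨f', hf'⟩, ⟨w', hw'⟩⟩ h
    obtain ⟨rfl, rfl⟩ := List.cons.inj (Subtype.ext_iff.1 h)
    rfl
  refine le_trans (le_of_eq ?_) (ENNReal.tsum_comp_le_tsum_of_injective hj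
    fun w => ENNReal.ofReal (Real.exp (-s * wordLen ℓ w.1)))
  rw [ENNReal.tsum_sigma', tsum_fintype, ← Finset.sum_subtype_eq_sum_filter,
    Finset.subtype_univ]
  refine Finset.sum_congr rfl fun f _ => ?_
  rw [wordSeries, ← ENNReal.tsum_mul_left]
  refine tsum_congr fun w => ?_
  rw [← ENNReal.ofReal_mul (Real.exp_pos _).le, ← Real.exp_add, wordLen_cons]
  ring_nf

/-- If any letter can be reached from any other one, then the series of all words that follow a
given letter converges as soon as the series of the words from `A` to `B` does: every word can be
completed to a word from `A` to `B` by adding one of finitely many prefixes and suffixes. -/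
theorem wordSeries_lt_top [Fintype D] (r : D → D → Prop) (hr : ∀ e f, Relation.ReflTransGen r e f)
    (ℓ : D → ℝ) {s : ℝ} (hs : 0 ≤ s) {a b : D} (A B : D → Prop) (ha : A a) (hb : B b)
    (hsum : ∑' w : WordsBetween r A B,
      ENNReal.ofReal (Real.exp (-s * wordLen ℓ w.1)) < ⊤) (e : D) :
    wordSeries r ℓ s e < ⊤ := by
  obtain ⟨u, hu, hua⟩ : ∃ u, List.IsChain r (u ++ [e]) ∧ (u ++ [e]).head? = some a := by
    obtain ⟨l, hl, hle⟩ := List.exists_isChain_cons_of_relationReflTransGen (hr a e)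
    refine ⟨(a :: l).dropLast, ?_⟩
    rw [← hle, List.dropLast_append_getLast]
    exact ⟨hl, rfl⟩
  have hv : ∀ f, ∃ v, List.IsChain r (f :: v) ∧ (f :: v).getLast? = some b := by
    intro f
    obtain ⟨l, hl, hle⟩ := List.exists_isChain_cons_of_relationReflTransGen (hr f b)
    exact ⟨l, hl, by rw [← hle, List.getLast?_eq_getLast_of_ne_nil]⟩
  choose v hv hvb using hv
  obtain ⟨last, hlast⟩ : ∃ last : List D → D, ∀ w, (e :: w).dropLast ++ [last w] = e :: w :=
    ⟨fun w => (e :: w).getLast (List.cons_ne_nil _ _), fun w => List.dropLast_append_getLast _⟩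
  have key : ∀ w : WordsAfter r e,
      List.IsChain r (u ++ (e :: w.1) ++ v (last w.1)) ∧
        (∃ x ∈ (u ++ (e :: w.1) ++ v (last w.1)).head?, A x) ∧
        ∃ x ∈ (u ++ (e :: w.1) ++ v (last w.1)).getLast?, B x := by
    intro w
    have h1 : List.IsChain r (u ++ (e :: w.1)) := List.isChain_split.2 ⟨hu, w.2⟩
    have h2 : u ++ (e :: w.1) = (u ++ (e :: w.1).dropLast) ++ [last w.1] := by
      rw [List.append_assoc, hlast]
    have h3 : u ++ (e :: w.1) ++ v (last w.1) =
        (u ++ (e :: w.1).dropLast) ++ (last w.1 :: v (last w.1)) := by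
      rw [h2]; simp
    refine ⟨?_, ⟨a, ?_, ha⟩, ⟨b, ?_, hb⟩⟩
    · rw [h3]
      rw [h2] at h1
      exact List.isChain_split.2 ⟨h1, hv _⟩
    · have : u ++ e :: w.1 ++ v (last w.1) = (u ++ [e]) ++ (w.1 ++ v (last w.1)) := by simp
      rw [this, List.head?_append, hua]
      rfl
    · rw [h3, List.getLast?_append, hvb]
      rfl
  let j : WordsAfter r e → WordsBetween r A B × D := fun w => (⟨_, key w⟩, last w.1)
  have hj : Function.Injective j := by
    intro w w' h
    obtain ⟨h1, h2⟩ := Prod.ext_iff.1 h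
    have h2' : last w.1 = last w'.1 := h2
    have h1' : u ++ (e :: w.1) ++ v (last w.1) = u ++ (e :: w'.1) ++ v (last w'.1) :=
      Subtype.ext_iff.1 h1
    rw [h2', List.append_assoc, List.append_assoc, List.append_right_inj,
      List.append_left_inj] at h1'
    exact Subtype.ext (List.cons.inj h1').2
  obtain ⟨M, hM⟩ : ∃ M, ∀ f, wordLen ℓ (u ++ [e]) + wordLen ℓ (v f) ≤ M :=
    let ⟨M, hM⟩ := (Set.finite_range fun f => wordLen ℓ (u ++ [e]) + wordLen ℓ (v f)).bddAbove
    ⟨M, fun f => hM ⟨f, rfl⟩⟩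
  calc wordSeries r ℓ s e
      ≤ ∑' w, ENNReal.ofReal (Real.exp (s * M)) *
          ENNReal.ofReal (Real.exp (-s * wordLen ℓ (j w).1.1)) := by
        unfold wordSeries
        gcongr with w
        rw [← ENNReal.ofReal_mul (Real.exp_pos _).le, ← Real.exp_add]
        refine ENNReal.ofReal_le_ofReal (Real.exp_le_exp.2 ?_)
        have h1 : wordLen ℓ (j w).1.1 =
            wordLen ℓ (u ++ [e]) + wordLen ℓ (v (last w.1)) + wordLen ℓ w.1 := by
          simp only [j, wordLen_append, wordLen_cons, wordLen_nil]
          ring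
        have h2 := mul_le_mul_of_nonneg_left (hM (last w.1)) hs
        rw [h1]
        linarith
    _ ≤ ∑' x : WordsBetween r A B × D, ENNReal.ofReal (Real.exp (s * M)) *
          ENNReal.ofReal (Real.exp (-s * wordLen ℓ x.1.1)) :=
        ENNReal.tsum_comp_le_tsum_of_injective hj fun x => ENNReal.ofReal (Real.exp (s * M)) *
          ENNReal.ofReal (Real.exp (-s * wordLen ℓ x.1.1))
    _ < ⊤ := by
        rw [ENNReal.tsum_mul_left]
        refine ENNReal.mul_lt_top ENNReal.ofReal_lt_top ?_
        rw [ENNReal.tsum_prod', ENNReal.tsum_comm, tsum_fintype]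
        exact ENNReal.sum_lt_top.2 fun _ _ => hsum

open Classical in
/-- A positive supersolution at the critical exponent `h` itself. This replaces the
Perron-Frobenius eigenvector of the transfer matrix. -/
theorem exists_pos_supersolution [Fintype D] [Nonempty D] (r : D → D → Prop)
    (hr : ∀ e f, Relation.ReflTransGen r e f)
    (ℓ : D → ℝ) {h : ℝ} (hX : ∀ s, h < s → ∀ e, wordSeries r ℓ s e < ⊤) :
    ∃ x : D → ℝ, (∀ e, 0 < x e) ∧
      ∀ e, ∑ f with r e f, Real.exp (-h * ℓ f) * x f ≤ x e := by
  -- The normalised vectors of series for `s > h` form a relatively compact family; a limit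
  -- point for `s → h` is the desired vector.
  let K : Set (ℝ × (D → ℝ)) := (Set.Icc h (h + 1) ×ˢ stdSimplex ℝ D) ∩
    {y | ∀ e, ∑ f with r e f, Real.exp (-y.1 * ℓ f) * y.2 f ≤ y.2 e}
  have hK : IsCompact K := by
    refine (isCompact_Icc.prod (isCompact_stdSimplex ℝ D)).inter_right ?_
    rw [Set.ofPred_forall]
    exact isClosed_iInter fun e => isClosed_le (by fun_prop) (by fun_prop)
  have hsub : Set.Ioc h (h + 1) ⊆ Prod.fst '' K := by
    intro s hs
    let X : D → ℝ := fun e => (wordSeries r ℓ s e).toReal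
    have hXpos : ∀ e, 0 < X e := fun e => ENNReal.toReal_pos
      (zero_lt_one.trans_le (one_le_wordSeries r ℓ s e)).ne' (hX s hs.1 e).ne
    have hXle : ∀ e, ∑ f with r e f, Real.exp (-s * ℓ f) * X f ≤ X e := by
      intro e
      have := ENNReal.toReal_mono (hX s hs.1 e).ne (sum_wordSeries_le r ℓ s e)
      rw [ENNReal.toReal_sum] at this
      · simpa only [ENNReal.toReal_mul, ENNReal.toReal_ofReal (Real.exp_pos _).le] using this
      · exact fun f _ => (ENNReal.mul_lt_top ENNReal.ofReal_lt_top (hX s hs.1 f)).ne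
    have hT : 0 < ∑ e, X e := Finset.sum_pos (fun e _ => hXpos e) Finset.univ_nonempty
    refine ⟨(s, fun e => X e / ∑ e, X e), ⟨⟨⟨hs.1.le, hs.2⟩, fun e => ?_, ?_⟩, fun e => ?_⟩, rfl⟩
    · exact (div_pos (hXpos e) hT).le
    · rw [← Finset.sum_div, div_self hT.ne']
    · simp only [← mul_div_assoc]
      rw [← Finset.sum_div]
      exact div_le_div_of_nonneg_right (hXle e) hT.le
  obtain ⟨⟨s, x⟩, ⟨⟨-, hx0, hx1⟩, hx⟩, rfl⟩ : h ∈ Prod.fst '' K := by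
    refine (hK.image continuous_fst).isClosed.closure_subset_iff.2 hsub ?_
    rw [closure_Ioc (by simp)]
    simp
  refine ⟨x, ?_, hx⟩
  obtain ⟨f, hf⟩ : ∃ f, 0 < x f := by
    by_contra! hcon
    have := Finset.sum_nonpos fun e (_ : e ∈ Finset.univ) => hcon e
    rw [hx1] at this
    linarith
  intro e
  refine Relation.ReflTransGen.head_induction_on (hr e f) hf fun {a c} hac _ hc => ?_
  refine lt_of_lt_of_le (mul_pos (Real.exp_pos _) hc) ((Finset.single_le_sum
    (f := fun f => Real.exp (-s * ℓ f) * x f) (fun f _ => ?_) ?_).trans (hx a))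
  · exact mul_nonneg (Real.exp_pos _).le (hx0 f)
  · simpa using hac

end Words

/-- A graph in the sense of Serre: every oriented edge (dart) `e` has a terminal vertex `tip e` and
an opposite dart `rev e`. -/
structure DartGraph (V D : Type*) where
  /-- the terminal vertex of a dart -/
  tip : D → V
  /-- the opposite dart -/
  rev : D → D
  rev_rev : ∀ e, rev (rev e) = e

namespace DartGraph

variable {V D : Type*} (G : DartGraph V D)

/-- `G.Step e f` means that the edge-path `f, e` makes sense and does not backtrack. Words of darts
are read backwards, from the end of an edge-path to its beginning. -/
def Step (e f : D) : Prop := G.tip (G.rev e) = G.tip f ∧ f ≠ G.rev e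

theorem rev_injective : Function.Injective G.rev :=
  Function.LeftInverse.injective G.rev_rev

theorem Step.rev {G : DartGraph V D} {e f : D} (h : G.Step e f) : G.Step (G.rev f) (G.rev e) :=
  ⟨by rw [G.rev_rev]; exact h.1.symm, by rw [G.rev_rev]; exact h.2.symm⟩

variable [Fintype D]

open Classical in
/-- The number of darts that end at a given vertex. -/
noncomputable def deg (v : V) : ℕ := (Finset.univ.filter fun e => G.tip e = v).card

/-- The number of continuations of an edge-path without backtracking that has reached `v`. -/
noncomputable def branching (v : V) : ℝ := (G.deg v : ℝ) - 1

open Classical in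
theorem card_successors (e : D) :
    ((Finset.univ.filter (G.Step e)).card : ℝ) = G.branching (G.tip (G.rev e)) := by
  have : Finset.univ.filter (G.Step e) =
      (Finset.univ.filter fun f => G.tip f = G.tip (G.rev e)).erase (G.rev e) := by
    ext f
    simp [Step, and_comm, eq_comm]
  rw [this, Finset.cast_card_erase_of_mem (by simp)]
  rfl

open Classical in
theorem card_predecessors (f : D) :
    ((Finset.univ.filter fun e => G.Step e f).card : ℝ) = G.branching (G.tip f) := by
  have : (Finset.univ.filter (G.Step (G.rev f))).image G.rev =
      Finset.univ.filter fun e => G.Step e f := by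
    ext e
    simp only [Finset.mem_image, Finset.mem_filter, Finset.mem_univ, true_and]
    refine ⟨?_, fun h => ⟨_, h.rev, G.rev_rev e⟩⟩
    rintro ⟨a, ha, rfl⟩
    simpa [G.rev_rev] using ha.rev
  rw [← this, Finset.card_image_of_injective _ G.rev_injective, card_successors, G.rev_rev]

theorem exists_tip_eq_ne_ne (hdeg : ∀ v, 3 ≤ G.deg v) (v : V) (a b : D) :
    ∃ g, G.tip g = v ∧ g ≠ a ∧ g ≠ b := by
  classical
  have h1 : ({a, b} : Finset D).card < (Finset.univ.filter fun e => G.tip e = v).card :=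
    lt_of_le_of_lt Finset.card_le_two (hdeg v)
  obtain ⟨g, hg, hg'⟩ := Finset.exists_mem_notMem_of_card_lt_card h1
  simp only [Finset.mem_filter, Finset.mem_univ, true_and, Finset.mem_insert,
    Finset.mem_singleton, not_or] at hg hg'
  exact ⟨g, hg, hg'⟩

theorem exists_tip_eq (hdeg : ∀ v, 3 ≤ G.deg v) (v : V) : ∃ g, G.tip g = v := by
  classical
  obtain ⟨g, hg⟩ := Finset.card_pos.1 (show 0 < G.deg v from (hdeg v).trans_lt' (by norm_num))
  exact ⟨g, (Finset.mem_filter.1 hg).2⟩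

theorem exists_common_predecessor (hdeg : ∀ v, 3 ≤ G.deg v) {a b : D} (h : G.tip a = G.tip b) :
    ∃ g, G.Step g a ∧ G.Step g b := by
  -- A third dart `g` at the common vertex can be run backwards before `a` and before `b`.
  obtain ⟨g, hg, ha, hb⟩ := G.exists_tip_eq_ne_ne hdeg (G.tip a) a b
  exact ⟨G.rev g, ⟨by rw [G.rev_rev, hg], by rw [G.rev_rev]; exact ha.symm⟩,
    ⟨by rw [G.rev_rev, hg, h], by rw [G.rev_rev]; exact hb.symm⟩⟩

theorem exists_step (hdeg : ∀ v, 3 ≤ G.deg v) (e : D) : ∃ f, G.Step e f := by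
  obtain ⟨g, hg, ha, -⟩ := G.exists_tip_eq_ne_ne hdeg (G.tip (G.rev e)) (G.rev e) (G.rev e)
  exact ⟨g, hg.symm, ha⟩

theorem two_le_branching (hdeg : ∀ v, 3 ≤ G.deg v) (v : V) : 2 ≤ G.branching v := by
  have : (3 : ℝ) ≤ G.deg v := by exact_mod_cast hdeg v
  unfold branching
  linarith

/-! ### Irreducibility of the non-backtracking walk -/

/-- Steps can be undone by a sequence of steps: the transition matrix of the non-backtracking
random walk is doubly stochastic, so a set of darts that is closed under steps is also closed under
inverse steps. -/
theorem reflTransGen_of_step (hdeg : ∀ v, 3 ≤ G.deg v) {a b : D} (hab : G.Step a b) :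
    Relation.ReflTransGen G.Step b a := by
  classical
  by_contra hcon
  -- `S` is closed under steps; `a` would be a predecessor of `b ∈ S` outside `S`.
  let S : Finset D := Finset.univ.filter (Relation.ReflTransGen G.Step b)
  have hk : ∀ v, 0 < G.branching v := fun v => two_pos.trans_le (G.two_le_branching hdeg v)
  have h1 : (S.card : ℝ) = ∑ f ∈ S, ∑ e ∈ S with G.Step e f, (G.branching (G.tip f))⁻¹ := by
    calc (S.card : ℝ) = ∑ e ∈ S, ∑ f with G.Step e f, (G.branching (G.tip f))⁻¹ := by
          rw [Finset.card_eq_sum_ones, Nat.cast_sum]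
          refine Finset.sum_congr rfl fun e _ => ?_
          rw [Finset.sum_congr rfl fun f hf => by
            rw [← (Finset.mem_filter.1 hf).2.1], Finset.sum_const, nsmul_eq_mul, card_successors,
            mul_inv_cancel₀ (hk _).ne', Nat.cast_one]
      _ = ∑ e ∈ S, ∑ f ∈ S with G.Step e f, (G.branching (G.tip f))⁻¹ := by
          refine Finset.sum_congr rfl fun e he => Finset.sum_congr ?_ fun _ _ => rfl
          ext f
          simp only [S, Finset.mem_filter, Finset.mem_univ, true_and] at he ⊢
          exact ⟨fun h => ⟨he.tail h, h⟩, fun h => h.2⟩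
      _ = _ := by
          simp only [Finset.sum_filter]
          exact Finset.sum_comm
  have h2 : ∀ f, ∑ e ∈ S with G.Step e f, (G.branching (G.tip f))⁻¹ =
      ((S.filter fun e => G.Step e f).card : ℝ) * (G.branching (G.tip f))⁻¹ := fun f => by
    rw [Finset.sum_const, nsmul_eq_mul]
  have h3 : ∀ f, G.branching (G.tip f) * (G.branching (G.tip f))⁻¹ = 1 := fun f =>
    mul_inv_cancel₀ (hk _).ne'
  have h4 : ∑ f ∈ S, ∑ e ∈ S with G.Step e f, (G.branching (G.tip f))⁻¹ < ∑ f ∈ S, 1 := by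
    refine Finset.sum_lt_sum (fun f _ => ?_) ⟨b, ?_, ?_⟩
    · rw [h2, ← h3 f, ← card_predecessors]
      gcongr
      exact Finset.subset_univ _
    · simp only [S, Finset.mem_filter, Finset.mem_univ, true_and]
      exact Relation.ReflTransGen.refl
    · rw [h2, ← h3 b, ← card_predecessors]
      refine mul_lt_mul_of_pos_right (Nat.cast_lt.2 (Finset.card_lt_card ?_)) ?_
      · refine Finset.ssubset_iff_subset_ne.2
          ⟨Finset.filter_subset_filter _ (Finset.subset_univ _), fun heq => hcon ?_⟩
        have : a ∈ Finset.univ.filter fun e => G.Step e b := by simpa using hab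
        rw [← heq] at this
        simpa [S] using (Finset.mem_filter.1 this).1
      · rw [card_predecessors]
        exact inv_pos.2 (hk _)
  rw [← h1] at h4
  simp at h4

/-- Any dart can be reached from any other one by an edge-path without backtracking. -/
theorem reflTransGen_step (hdeg : ∀ v, 3 ≤ G.deg v)
    (hconn : ∀ u v, Relation.ReflTransGen (fun u v => ∃ e, G.tip e = u ∧ G.tip (G.rev e) = v) u v)
    (e f : D) : Relation.ReflTransGen G.Step e f := by
  have same : ∀ e f, G.tip e = G.tip f → Relation.ReflTransGen G.Step e f := by
    intro e f h
    obtain ⟨g, h1, h2⟩ := G.exists_common_predecessor hdeg h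
    exact (G.reflTransGen_of_step hdeg h1).tail h2
  have next : ∀ e f, G.tip (G.rev e) = G.tip f → Relation.ReflTransGen G.Step e f := by
    intro e f h
    obtain ⟨g, hg⟩ := G.exists_step hdeg e
    exact Relation.ReflTransGen.head hg (same g f (hg.1.symm.trans h))
  have key : ∀ v, Relation.ReflTransGen (fun u v => ∃ e, G.tip e = u ∧ G.tip (G.rev e) = v)
      (G.tip e) v → ∀ f, G.tip f = v → Relation.ReflTransGen G.Step e f := by
    intro v hv
    induction hv with
    | refl => exact fun f hf => same e f hf.symm
    | tail _ h ih =>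
      obtain ⟨g, hg, hg'⟩ := h
      exact fun f hf => (ih g hg).trans (next g f (hg'.trans hf.symm))
  exact key _ (hconn _ _) f rfl

/-! ### The entropy inequality -/

/-- Each vertex is the initial vertex of as many darts as end there. -/
theorem sum_tip_rev (F : V → ℝ) [Fintype V] :
    ∑ e, F (G.tip (G.rev e)) = ∑ v, (G.deg v : ℝ) * F v := by
  classical
  have : ∑ e, F (G.tip (G.rev e)) = ∑ e, F (G.tip e) :=
    Equiv.sum_comp (Function.Involutive.toPerm G.rev G.rev_rev) fun e => F (G.tip e)
  rw [this, ← Finset.sum_fiberwise_of_maps_to (t := Finset.univ) (g := G.tip) (by simp)]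
  refine Finset.sum_congr rfl fun v _ => ?_
  rw [Finset.sum_congr rfl fun e he => by rw [(Finset.mem_filter.1 he).2], Finset.sum_const,
    nsmul_eq_mul, deg]

open Classical in
/-- The lower bound on `h` that a positive supersolution `x` with exponent `h` implies. It results
from summing `log t ≤ t - 1` over all steps `(e, f)` with the weights `1 / k e`, where `k e` is the
number of successors of `e` and `t = k e * exp (-h * ℓ f) * x f / x e`. The sum of `log (x f / x e)`
cancels because the uniform non-backtracking walk preserves the counting measure on the darts. In
the case of equality all `t` have to be one. -/
theorem entropy_inequality (hdeg : ∀ v, 3 ≤ G.deg v) (ℓ x : D → ℝ) {h : ℝ}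
    (hx : ∀ e, 0 < x e) (hsup : ∀ e, ∑ f with G.Step e f, Real.exp (-h * ℓ f) * x f ≤ x e) :
    (∑ e, Real.log (G.branching (G.tip (G.rev e))) ≤ h * ∑ e, ℓ e) ∧
    (∑ e, Real.log (G.branching (G.tip (G.rev e))) = h * ∑ e, ℓ e → ∀ e f, G.Step e f →
      G.branching (G.tip (G.rev e)) * (Real.exp (-h * ℓ f) * x f) = x e) := by
  set k : D → ℝ := fun e => G.branching (G.tip (G.rev e)) with hk
  set y : D → ℝ := fun f => Real.exp (-h * ℓ f) * x f with hy
  have kpos : ∀ e, 0 < k e := fun e => two_pos.trans_le (G.two_le_branching hdeg _)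
  have ypos : ∀ f, 0 < y f := fun f => mul_pos (Real.exp_pos _) (hx f)
  have tpos : ∀ e f, 0 < k e * y f / x e := fun e f =>
    div_pos (mul_pos (kpos e) (ypos f)) (hx e)
  have hle : ∀ e f, Real.log (k e * y f / x e) / k e ≤ (k e * y f / x e - 1) / k e := fun e f =>
    div_le_div_of_nonneg_right (Real.log_le_sub_one_of_pos (tpos e f)) (kpos e).le
  have h1 : ∑ e, ∑ f with G.Step e f, (k e * y f / x e - 1) / k e ≤ 0 := by
    refine Finset.sum_nonpos fun e _ => ?_
    have : ∀ f, (k e * y f / x e - 1) / k e = y f / x e - (k e)⁻¹ := fun f => by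
      have := (kpos e).ne'
      field_simp
    simp only [this]
    rw [Finset.sum_sub_distrib, ← Finset.sum_div, Finset.sum_const, nsmul_eq_mul, card_successors,
      mul_inv_cancel₀ (kpos e).ne', sub_nonpos]
    exact (div_le_one (hx e)).2 (hsup e)
  have h2 : ∑ e, ∑ f with G.Step e f, Real.log (k e * y f / x e) / k e =
      ∑ e, Real.log (k e) - h * ∑ e, ℓ e := by
    have e1 : ∀ e f, G.Step e f → Real.log (k e * y f / x e) / k e =
        (Real.log (k e) - Real.log (x e)) / k e + Real.log (y f) / G.branching (G.tip f) := by
      intro e f hef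
      rw [← hef.1, Real.log_div (mul_pos (kpos e) (ypos f)).ne' (hx e).ne',
        Real.log_mul (kpos e).ne' (ypos f).ne']
      simp only [hk]
      ring
    have e2 : ∑ e, ∑ f with G.Step e f, (Real.log (k e) - Real.log (x e)) / k e =
        ∑ e, (Real.log (k e) - Real.log (x e)) := by
      refine Finset.sum_congr rfl fun e _ => ?_
      rw [Finset.sum_const, nsmul_eq_mul, card_successors]
      exact mul_div_cancel₀ _ (kpos e).ne'
    have e3 : ∑ e, ∑ f with G.Step e f, Real.log (y f) / G.branching (G.tip f) =
        ∑ f, Real.log (y f) := by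
      simp only [Finset.sum_filter]
      rw [Finset.sum_comm]
      refine Finset.sum_congr rfl fun f _ => ?_
      rw [← Finset.sum_filter, Finset.sum_const, nsmul_eq_mul, card_predecessors]
      exact mul_div_cancel₀ _ (two_pos.trans_le (G.two_le_branching hdeg _)).ne'
    have e4 : ∀ f, Real.log (y f) = Real.log (x f) - h * ℓ f := fun f => by
      rw [hy, Real.log_mul (Real.exp_pos _).ne' (hx f).ne', Real.log_exp]
      ring
    rw [Finset.sum_congr rfl fun e _ => Finset.sum_congr rfl fun f hf =>
      e1 e f (Finset.mem_filter.1 hf).2]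
    simp only [Finset.sum_add_distrib]
    rw [e2, e3, Finset.sum_congr rfl fun f _ => e4 f, Finset.sum_sub_distrib,
      Finset.sum_sub_distrib, ← Finset.mul_sum]
    ring
  have h3 : ∑ e, ∑ f with G.Step e f, Real.log (k e * y f / x e) / k e ≤
      ∑ e, ∑ f with G.Step e f, (k e * y f / x e - 1) / k e :=
    Finset.sum_le_sum fun e _ => Finset.sum_le_sum fun f _ => hle e f
  refine ⟨by linarith, fun heq e f hef => ?_⟩
  by_contra hne
  have hlt : Real.log (k e * y f / x e) / k e < (k e * y f / x e - 1) / k e := by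
    refine div_lt_div_of_pos_right (Real.log_lt_sub_one_of_pos (tpos e f) fun h => hne ?_) (kpos e)
    exact (div_eq_one_iff_eq (hx e).ne').1 h
  have h4 : ∑ e, ∑ f with G.Step e f, Real.log (k e * y f / x e) / k e <
      ∑ e, ∑ f with G.Step e f, (k e * y f / x e - 1) / k e :=
    Finset.sum_lt_sum (fun e _ => Finset.sum_le_sum fun f _ => hle e f)
      ⟨e, Finset.mem_univ e, Finset.sum_lt_sum (fun f _ => hle e f) ⟨f, by simpa using hef, hlt⟩⟩
  linarith

/-- Trivalent graphs with equality in the entropy inequality: the quantity `exp (-h * ℓ a) * x a`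
depends only on the vertex at which `a` ends, and comparing it for `e` and `G.rev e` gives
`(2 * exp (-h * ℓ e)) ^ 2 = 1`. -/
theorem mul_length_eq_log_two (h3 : ∀ v, G.deg v = 3) (ℓ x : D → ℝ)
    (hℓ : ∀ e, ℓ (G.rev e) = ℓ e) {h : ℝ} (hx : ∀ e, 0 < x e)
    (heq : ∀ e f, G.Step e f →
      G.branching (G.tip (G.rev e)) * (Real.exp (-h * ℓ f) * x f) = x e) (e : D) :
    h * ℓ e = Real.log 2 := by
  have hdeg : ∀ v, 3 ≤ G.deg v := fun v => (h3 v).ge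
  have hk : ∀ v, G.branching v = 2 := fun v => by rw [branching, h3]; norm_num
  simp only [hk] at heq
  have hsame : ∀ a b, G.tip a = G.tip b →
      Real.exp (-h * ℓ a) * x a = Real.exp (-h * ℓ b) * x b := by
    intro a b hab
    obtain ⟨g, ha, hb⟩ := G.exists_common_predecessor hdeg hab
    have := (heq g a ha).trans (heq g b hb).symm
    linarith
  have key : ∀ e, x e = 2 * (Real.exp (-h * ℓ e) * x (G.rev e)) := by
    intro e
    obtain ⟨f, hf⟩ := G.exists_step hdeg e
    rw [← heq e f hf, hsame f (G.rev e) hf.1.symm, hℓ]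
  have h1 := key e
  have h2 := key (G.rev e)
  rw [G.rev_rev, hℓ] at h2
  have h4 : (2 * Real.exp (-h * ℓ e)) ^ 2 = 1 := by
    have : x e * (2 * Real.exp (-h * ℓ e)) ^ 2 = x e * 1 := by
      calc x e * (2 * Real.exp (-h * ℓ e)) ^ 2
          = 2 * (Real.exp (-h * ℓ e) * (2 * (Real.exp (-h * ℓ e) * x e))) := by ring
        _ = x e * 1 := by rw [← h2, ← h1, mul_one]
    exact mul_left_cancel₀ (hx e).ne' this
  have h5 : 2 * Real.exp (-h * ℓ e) = 1 :=
    (pow_eq_one_iff_of_nonneg (by positivity) two_ne_zero).1 h4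
  have h6 : Real.exp (h * ℓ e) = 2 := by
    rw [neg_mul, Real.exp_neg] at h5
    field_simp at h5
    linarith
  rw [← h6, Real.log_exp]

end DartGraph

/-! ### The rank of the fundamental group -/

namespace Quiver.FreeGroupoid

variable (V : Type) [Quiver.{0} V]

/-- The free groupoid on a quiver is free in the sense of the universal property for groups. -/
instance : IsFreeGroupoid (Quiver.FreeGroupoid V) where
  quiverGenerators := ⟨fun a b => @Quiver.Hom V _ a.as b.as⟩
  of := fun {a b} e => (Quiver.FreeGroupoid.of V).map (X := a.as) (Y := b.as) e
  unique_lift := by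
    intro A _ f
    let φ : V ⥤q SingleObj A :=
      { obj := fun _ => SingleObj.star A
        map := fun {a b} e => @f (⟨a⟩ : Quiver.FreeGroupoid V) (⟨b⟩ : Quiver.FreeGroupoid V) e }
    refine ⟨lift φ, fun a b g => ?_, fun F hF => ?_⟩
    · exact Prefunctor.congr_hom (lift_spec φ) (X := a.as) (Y := b.as) g
    · refine lift_unique φ F ?_
      refine Prefunctor.ext (fun _ => rfl) fun a b e => ?_
      exact hF (⟨a⟩ : Quiver.FreeGroupoid V) (⟨b⟩ : Quiver.FreeGroupoid V) e

/-- Functors from the free groupoid to a group are labellings of the edges. -/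
noncomputable def functorEquiv (A : Type) [Group A] :
    (Quiver.FreeGroupoid V ⥤ SingleObj A) ≃ ((Σ a b : V, (a ⟶ b)) → A) where
  toFun F e := F.map ((of V).map e.2.2)
  invFun f := lift
    { obj := fun _ => SingleObj.star A
      map := fun {a b} e => f ⟨a, b, e⟩ }
  left_inv F := by
    symm
    refine lift_unique _ F ?_
    exact Prefunctor.ext (fun _ => rfl) fun a b e => rfl
  right_inv f := by
    ext ⟨a, b, e⟩
    exact Prefunctor.congr_hom (lift_spec
      { obj := fun _ => SingleObj.star A
        map := fun {a b} e => f ⟨a, b, e⟩ : V ⥤q SingleObj A }) e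

end Quiver.FreeGroupoid

section SingleObj

variable {C : Type} [Groupoid.{0} C] {A : Type}

/-- The value of a functor to a group on an arrow, regarded as an element of the group. -/
def groupValue [Group A] (F : C ⥤ SingleObj A) {a b : C} (g : a ⟶ b) : A := F.map g

theorem groupValue_comp [Group A] (F : C ⥤ SingleObj A) {a b c : C} (g : a ⟶ b) (h : b ⟶ c) :
    groupValue F (g ≫ h) = groupValue F h * groupValue F g := F.map_comp g h

theorem groupValue_id [Group A] (F : C ⥤ SingleObj A) (a : C) : groupValue F (𝟙 a) = 1 :=
  F.map_id a

theorem groupValue_inv [Group A] (F : C ⥤ SingleObj A) {a b : C} (g : a ⟶ b) :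
    groupValue F (inv g) = (groupValue F g)⁻¹ := by
  rw [eq_inv_iff_mul_eq_one, ← groupValue_comp, IsIso.hom_inv_id, groupValue_id]

/-- The functor to a group that is given by a multiplicative function on arrows. -/
def functorOfGroupValue [Group A] (φ : ∀ {a b : C}, (a ⟶ b) → A)
    (hid : ∀ a : C, φ (𝟙 a) = 1)
    (hcomp : ∀ {a b c : C} (g : a ⟶ b) (h : b ⟶ c), φ (g ≫ h) = φ h * φ g) :
    C ⥤ SingleObj A where
  obj _ := SingleObj.star A
  map g := φ g
  map_id := hid
  map_comp := hcomp

theorem functor_ext_groupValue [Group A] {F F' : C ⥤ SingleObj A}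
    (h : ∀ {a b : C} (g : a ⟶ b), groupValue F g = groupValue F' g) : F = F' :=
  CategoryTheory.Functor.hext (fun _ => rfl) fun _ _ g => heq_of_eq (h g)

/-- A functor from a connected groupoid to an abelian group is determined by its restriction to a
vertex group and by its values on a star of arrows `t v` from that vertex. The value on
`t p = 𝟙 p` is trivial; the additional factor `A` scales the values on the star, so that they
become an arbitrary function on the set of objects. -/
noncomputable def functorProdEquiv (p : C) (t : ∀ v : C, p ⟶ v)
    (ht : t p = 𝟙 p) (A : Type) [CommGroup A] :
    (C ⥤ SingleObj A) × A ≃ (End p →* A) × (C → A) where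
  toFun Fa := (⟨⟨fun g => groupValue Fa.1 (show p ⟶ p from g), groupValue_id _ _⟩,
    fun g h => groupValue_comp Fa.1 (show p ⟶ p from h) (show p ⟶ p from g)⟩,
    fun v => Fa.2 * groupValue Fa.1 (t v))
  invFun fc := (functorOfGroupValue
    (fun {a b} g => (fc.2 a)⁻¹ * fc.1 (End.of (t a ≫ g ≫ inv (t b))) * fc.2 b)
    (fun a => by
      have : End.of (t a ≫ 𝟙 a ≫ inv (t a)) = 1 := by
        change t a ≫ 𝟙 a ≫ inv (t a) = 𝟙 p
        rw [Category.id_comp, IsIso.hom_inv_id]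
      rw [this, map_one, mul_one, inv_mul_cancel])
    (fun {a b c} g h => by
      have : End.of (t a ≫ (g ≫ h) ≫ inv (t c)) =
          End.of (t b ≫ h ≫ inv (t c)) * End.of (t a ≫ g ≫ inv (t b)) := by
        change t a ≫ (g ≫ h) ≫ inv (t c) = (t a ≫ g ≫ inv (t b)) ≫ t b ≫ h ≫ inv (t c)
        simp only [Category.assoc, IsIso.inv_hom_id_assoc]
      rw [this, map_mul, mul_comm (fc.1 _) (fc.1 _)]
      simp only [mul_assoc]
      simp only [mul_comm, mul_left_comm, mul_inv_cancel_left]), fc.2 p)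
  left_inv := by
    rintro ⟨F, a⟩
    refine Prod.ext (functor_ext_groupValue fun {u v} g => ?_) ?_
    · change (a * groupValue F (t u))⁻¹ * groupValue F (t u ≫ g ≫ inv (t v)) *
        (a * groupValue F (t v)) = groupValue F g
      rw [groupValue_comp, groupValue_comp, groupValue_inv]
      calc _ = (a * groupValue F (t u))⁻¹ * (a * groupValue F (t u)) *
            ((groupValue F (t v))⁻¹ * groupValue F (t v)) * groupValue F g := by ac_rfl
        _ = _ := by rw [inv_mul_cancel, inv_mul_cancel, one_mul, one_mul]
    · change a * groupValue F (t p) = a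
      rw [ht, groupValue_id, mul_one]
  right_inv := by
    rintro ⟨f, c⟩
    refine Prod.ext (MonoidHom.ext fun g => ?_) (funext fun v => ?_)
    · change (c p)⁻¹ * f (End.of (t p ≫ g ≫ inv (t p))) * c p = f g
      have : End.of (t p ≫ (show p ⟶ p from g) ≫ inv (t p)) = g := by
        change t p ≫ (show p ⟶ p from g) ≫ inv (t p) = g
        simp only [ht, IsIso.inv_id, Category.comp_id, Category.id_comp]
      rw [this, mul_right_comm, inv_mul_cancel, one_mul]
    · change c p * ((c p)⁻¹ * f (End.of (t p ≫ t v ≫ inv (t v))) * c v) = c v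
      have : End.of (t p ≫ t v ≫ inv (t v)) = 1 := by
        change t p ≫ t v ≫ inv (t v) = 𝟙 p
        rw [IsIso.hom_inv_id, ht, Category.comp_id]
      rw [this, map_one, mul_one, mul_inv_cancel_left]

end SingleObj

namespace MetricGraph

/-- The set of non-oriented edges. -/
abbrev Edge (Γ : MetricGraph) : Type := Σ a b : Γ.V, (a ⟶ b)

/-- The fundamental group of a connected graph is free of rank `k = |E| - |V| + 1`. Counting
functors from the fundamental groupoid to a group of order two in two ways gives
`2 ^ |E| * 2 = 2 ^ k * 2 ^ |V|`. -/
theorem exists_fundGroup_equiv (Γ : MetricGraph) (hΓ : Γ.IsConnected) (p : Γ.V) :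
    ∃ k : ℕ, Nonempty (Γ.FundGroup p ≃* FreeGroup (Fin k)) ∧
      Fintype.card Γ.Edge + 1 = Fintype.card Γ.V + k := by
  let C := Quiver.FreeGroupoid Γ.V
  have hhom : ∀ a b : C, Nonempty (a ⟶ b) := fun a b =>
    ⟨(CategoryTheory.Quotient.functor (Quiver.FreeGroupoid.redStep (V := Γ.V))).map
      (hΓ.2 a.as b.as).some⟩
  have : Nonempty C := ⟨Γ.base p⟩
  have : CategoryTheory.IsConnected C := CategoryTheory.zigzag_isConnected fun a b =>
    Relation.ReflTransGen.single (Or.inl (hhom a b))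
  have : IsFreeGroup (Γ.FundGroup p) := IsFreeGroupoid.endIsFreeOfConnectedFree (Γ.base p)
  let X := IsFreeGroup.Generators (Γ.FundGroup p)
  let e : Γ.FundGroup p ≃* FreeGroup X := IsFreeGroup.toFreeGroup _
  let A := Multiplicative (ZMod 2)
  obtain ⟨t, ht⟩ : ∃ t : ∀ v : C, Γ.base p ⟶ v, t (Γ.base p) = 𝟙 _ :=
    ⟨fun v => inv (hhom (Γ.base p) (Γ.base p)).some ≫ (hhom (Γ.base p) v).some,
      IsIso.inv_hom_id _⟩
  let eV : C ≃ Γ.V := ⟨fun a => a.as, fun v => ⟨v⟩, fun _ => rfl, fun _ => rfl⟩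
  let eX : (Γ.FundGroup p →* A) ≃ (X → A) :=
    (e.monoidHomCongrLeftEquiv).trans FreeGroup.lift.symm
  let E : (Γ.Edge → A) × A ≃ (X → A) × (Γ.V → A) :=
    (((Quiver.FreeGroupoid.functorEquiv Γ.V A).symm.prodCongr (Equiv.refl A)).trans
      (functorProdEquiv (Γ.base p) t ht A)).trans (eX.prodCongr (eV.arrowCongr (Equiv.refl A)))
  have : Finite ((X → A) × (Γ.V → A)) := Finite.of_equiv _ E
  have : Finite (X → A) := Finite.of_injective (fun f : X → A => (f, fun _ : Γ.V => (1 : A)))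
    fun f g h => (Prod.ext_iff.1 h).1
  have : Finite X := by
    classical
    -- The indicator functions of points embed `X` in the finite set `X → A`.
    refine Finite.of_injective (fun x : X => (Pi.mulSingle x (Multiplicative.ofAdd 1) : X → A)) ?_
    intro x y h
    by_contra hne
    have := congr_fun h x
    simp only [Pi.mulSingle_eq_same, Pi.mulSingle_eq_of_ne hne] at this
    exact absurd this (by decide)
  have := Fintype.ofFinite X
  refine ⟨Fintype.card X, ⟨e.trans (FreeGroup.freeGroupCongr (Fintype.equivFin X))⟩, ?_⟩
  have hA : Nat.card A = 2 := by simp [A]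
  have hc := Nat.card_congr E
  rw [Nat.card_prod, Nat.card_prod, Nat.card_fun, Nat.card_fun, Nat.card_fun, hA, ← pow_succ,
    ← pow_add, Nat.card_eq_fintype_card, Nat.card_eq_fintype_card, Nat.card_eq_fintype_card] at hc
  have := Nat.pow_right_injective le_rfl hc
  omega

/-- The rank of a free group is well defined, so the rank in `InModuli` is the first Betti
number. -/
theorem card_edge_add_one (Γ : MetricGraph) {k : ℕ} (hΓ : Γ.InModuli k) :
    Fintype.card Γ.Edge + 1 = Fintype.card Γ.V + k := by
  obtain ⟨p⟩ := hΓ.connected.1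
  obtain ⟨m, ⟨e⟩, hm⟩ := Γ.exists_fundGroup_equiv hΓ.connected p
  obtain ⟨e'⟩ := hΓ.rank p
  have := Fintype.card_congr (Equiv.ofFreeGroupEquiv (e'.symm.trans e))
  simp only [Fintype.card_fin] at this
  omega

end MetricGraph

/-! ### Reduced words and displacements -/

namespace MetricGraph

variable (Γ : MetricGraph)

/-- The oriented edges: `(e, true)` is the edge `e` with its reference orientation, and
`(e, false)` is its inverse, in agreement with the letters of `FreeGroup Γ.Edge`. -/
abbrev Dart : Type := Γ.Edge × Bool

/-- The graph of darts of a metric graph. -/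
def dartGraph : DartGraph Γ.V Γ.Dart where
  tip e := if e.2 then e.1.2.1 else e.1.1
  rev e := (e.1, !e.2)
  rev_rev e := by simp

/-- The length of a dart. -/
def dartLen (e : Γ.Dart) : ℝ := Γ.len e.1.2.2

theorem dartLen_pos (e : Γ.Dart) : 0 < Γ.dartLen e := Γ.len_pos _

/-- The dart that corresponds to an arrow of the symmetrified quiver. -/
def toDart {a b : Quiver.Symmetrify Γ.V} (e : a ⟶ b) : Γ.Dart :=
  Sum.elim (fun f : @Quiver.Hom Γ.V _ a b => ((⟨a, b, f⟩ : Γ.Edge), true))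
    (fun f : @Quiver.Hom Γ.V _ b a => ((⟨b, a, f⟩ : Γ.Edge), false)) e

variable {Γ}

theorem tip_toDart {a b : Quiver.Symmetrify Γ.V} (e : a ⟶ b) :
    Γ.dartGraph.tip (Γ.toDart e) = b := by
  rcases e with e | e <;> rfl

theorem tip_rev_toDart {a b : Quiver.Symmetrify Γ.V} (e : a ⟶ b) :
    Γ.dartGraph.tip (Γ.dartGraph.rev (Γ.toDart e)) = a := by
  rcases e with e | e <;> rfl

theorem toDart_reverse {a b : Quiver.Symmetrify Γ.V} (e : a ⟶ b) :
    Γ.toDart (Quiver.reverse e) = Γ.dartGraph.rev (Γ.toDart e) := by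
  rcases e with e | e <;> rfl

theorem dartLen_toDart {a b : Quiver.Symmetrify Γ.V} (e : a ⟶ b) :
    Γ.dartLen (Γ.toDart e) = Γ.orientedLen e := by
  rcases e with e | e <;> rfl

theorem toDart_injective {a b : Quiver.Symmetrify Γ.V} :
    Function.Injective (Γ.toDart (a := a) (b := b)) := by
  rintro (e | e) (f | f) h
  · cases h
    rfl
  · cases congrArg Prod.snd h
  · cases congrArg Prod.snd h
  · cases h
    rfl

theorem exists_toDart (d : Γ.Dart) :
    ∃ (a b : Quiver.Symmetrify Γ.V) (e : a ⟶ b), Γ.toDart e = d := by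
  obtain ⟨⟨a, b, e⟩, _ | _⟩ := d
  · exact ⟨b, a, Sum.inr e, rfl⟩
  · exact ⟨a, b, Sum.inl e, rfl⟩

/-- The word of darts of an edge-path, from its end to its beginning. -/
def word {a : Quiver.Symmetrify Γ.V} : ∀ {b : Quiver.Symmetrify Γ.V}, Quiver.Path a b → List Γ.Dart
  | _, .nil => []
  | _, .cons γ e => Γ.toDart e :: word γ

theorem pathLen_eq_wordLen {a b : Quiver.Symmetrify Γ.V} (γ : Quiver.Path a b) :
    Γ.pathLen γ = wordLen Γ.dartLen (word γ) := by
  induction γ with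
  | nil => rfl
  | cons γ e ih => rw [pathLen, word, wordLen_cons, ih, dartLen_toDart, add_comm]

theorem word_injective {a b : Quiver.Symmetrify Γ.V} (γ δ : Quiver.Path a b)
    (h : word γ = word δ) : γ = δ := by
  induction γ with
  | nil =>
    cases δ with
    | nil => rfl
    | cons δ f => cases h
  | cons γ e ih =>
    cases δ with
    | nil => cases h
    | cons δ f =>
      rw [word, word, List.cons.injEq] at h
      have hs := congrArg (fun d => Γ.dartGraph.tip (Γ.dartGraph.rev d)) h.1
      simp only [tip_rev_toDart] at hs
      subst hs
      rw [ih δ h.2, toDart_injective h.1]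

theorem isChain_word_cons {a b c : Quiver.Symmetrify Γ.V} {γ : Quiver.Path a b} {e : b ⟶ c}
    (hγ : List.IsChain Γ.dartGraph.Step (word γ))
    (h : ∀ f ∈ (word γ).head?, f ≠ Γ.dartGraph.rev (Γ.toDart e)) :
    List.IsChain Γ.dartGraph.Step (word (γ.cons e)) := by
  cases γ with
  | nil => exact List.isChain_singleton _
  | cons γ f =>
    refine List.isChain_cons_cons.2 ⟨⟨?_, h _ rfl⟩, hγ⟩
    rw [tip_rev_toDart, tip_toDart]

/-- The homotopy class of an edge-path, as an arrow of the fundamental groupoid. -/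
def pathClass {a b : Quiver.Symmetrify Γ.V} (γ : Quiver.Path a b) : Γ.base a ⟶ Γ.base b :=
  (CategoryTheory.Quotient.functor (Quiver.FreeGroupoid.redStep (V := Γ.V))).map
    (X := a) (Y := b) γ

theorem pathClass_cons_cons_reverse {a b c : Quiver.Symmetrify Γ.V} (γ : Quiver.Path a b)
    (e : b ⟶ c) : pathClass ((γ.cons e).cons (Quiver.reverse e)) = pathClass γ := by
  symm
  have h := CategoryTheory.Quotient.sound (Quiver.FreeGroupoid.redStep (V := Γ.V))
    (Quiver.FreeGroupoid.redStep.step b c e)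
  have h2 := congrArg (fun x => pathClass γ ≫ x) h
  exact h2

/-- Every edge-path is homotopic to one without backtracking. -/
theorem exists_reduced_path {a b : Quiver.Symmetrify Γ.V} (γ : Quiver.Path a b) :
    ∃ δ : Quiver.Path a b, pathClass δ = pathClass γ ∧
      List.IsChain Γ.dartGraph.Step (word δ) := by
  induction γ with
  | nil => exact ⟨.nil, rfl, List.isChain_nil⟩
  | @cons b c γ e ih =>
    obtain ⟨δ, hδ, hred⟩ := ih
    have hcl : pathClass (δ.cons e) = pathClass (γ.cons e) :=
      congrArg (fun x => x ≫ pathClass (Quiver.Hom.toPath e)) hδ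
    by_cases h : ∀ f ∈ (word δ).head?, f ≠ Γ.dartGraph.rev (Γ.toDart e)
    · exact ⟨δ.cons e, hcl, isChain_word_cons hred h⟩
    · push Not at h
      obtain ⟨d, hd, hde⟩ := h
      cases δ with
      | nil => cases hd
      | @cons x _ δ f =>
        cases hd
        have hx := congrArg (fun d => Γ.dartGraph.tip (Γ.dartGraph.rev d)) hde
        simp only [tip_rev_toDart, Γ.dartGraph.rev_rev, tip_toDart] at hx
        subst hx
        rw [← toDart_reverse] at hde
        cases toDart_injective hde
        refine ⟨δ, ?_, ?_⟩
        · rw [← hcl, ← pathClass_cons_cons_reverse δ (Quiver.reverse e), Quiver.reverse_reverse]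
        · exact (List.isChain_cons.1 hred).2

theorem exists_path_of_word (e : Γ.Dart) (w : List Γ.Dart)
    (h : List.IsChain Γ.dartGraph.Step (e :: w)) (a b : Quiver.Symmetrify Γ.V)
    (hb : Γ.dartGraph.tip e = b)
    (ha : ∀ f ∈ (e :: w).getLast?, Γ.dartGraph.tip (Γ.dartGraph.rev f) = a) :
    ∃ γ : Quiver.Path a b, word γ = e :: w := by
  induction w generalizing e b with
  | nil =>
    obtain ⟨a', b', f, rfl⟩ := exists_toDart e
    have ha : Γ.dartGraph.tip (Γ.dartGraph.rev (Γ.toDart f)) = a := ha _ rfl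
    rw [tip_rev_toDart] at ha
    rw [tip_toDart] at hb
    subst ha hb
    exact ⟨f.toPath, rfl⟩
  | cons d w ih =>
    obtain ⟨a', b', f, rfl⟩ := exists_toDart e
    rw [tip_toDart] at hb
    subst hb
    rw [List.isChain_cons_cons] at h
    obtain ⟨γ, hγ⟩ := ih d h.2 a' (by rw [← h.1.1, tip_rev_toDart]) (by simpa using ha)
    exact ⟨γ.cons f, by rw [word, hγ]⟩

variable (Γ)

/-- The functor from the fundamental groupoid to the free group on the edges that forgets the
vertices. Composition in `SingleObj` is reversed multiplication, which fits words that are read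
backwards. -/
noncomputable def wordFunctor : Quiver.FreeGroupoid Γ.V ⥤ SingleObj (FreeGroup Γ.Edge) :=
  (Quiver.FreeGroupoid.functorEquiv Γ.V (FreeGroup Γ.Edge)).symm FreeGroup.of

variable {Γ}

theorem groupValue_wordFunctor {a b : Quiver.Symmetrify Γ.V} (γ : Quiver.Path a b) :
    groupValue Γ.wordFunctor (pathClass γ) = FreeGroup.mk (word γ) := by
  have hof : ∀ {a b : Γ.V} (f : a ⟶ b),
      groupValue Γ.wordFunctor ((Quiver.FreeGroupoid.of Γ.V).map f) =
        FreeGroup.of (⟨a, b, f⟩ : Γ.Edge) := fun {a b} f =>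
    congrFun ((Quiver.FreeGroupoid.functorEquiv Γ.V (FreeGroup Γ.Edge)).apply_symm_apply
      FreeGroup.of) ⟨a, b, f⟩
  induction γ with
  | nil => exact groupValue_id _ _
  | cons γ e ih =>
    change groupValue Γ.wordFunctor (pathClass γ ≫ pathClass (Quiver.Hom.toPath e)) = _
    rw [groupValue_comp, ih, word, ← List.singleton_append, ← FreeGroup.mul_mk]
    congr 1
    rcases e with e | e
    · exact hof e
    · have : pathClass (Γ := Γ) (Quiver.Hom.toPath (V := Quiver.Symmetrify Γ.V) (Sum.inr e)) =
          inv ((Quiver.FreeGroupoid.of Γ.V).map e) := by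
        rw [← Groupoid.inv_eq_inv]
        rfl
      exact (congrArg (groupValue Γ.wordFunctor) this).trans
        ((groupValue_inv _ _).trans (congrArg _ (hof e)))

open Classical in
/-- The reduced word of an element of the fundamental group. -/
noncomputable def reducedWord {p : Γ.V} (g : Γ.FundGroup p) : List Γ.Dart :=
  (groupValue Γ.wordFunctor (show Γ.base p ⟶ Γ.base p from g)).toWord

/-- Edge-paths without backtracking give reduced words in the sense of free groups. -/
theorem isReduced_of_isChain {w : List Γ.Dart} (h : List.IsChain Γ.dartGraph.Step w) :
    FreeGroup.IsReduced w := by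
  refine h.imp fun e f hef h1 => ?_
  by_contra h2
  refine hef.2 (Prod.ext h1.symm ?_)
  change f.2 = !e.2
  revert h2
  cases e.2 <;> cases f.2 <;> simp

open Classical in
theorem reducedWord_homotopyClass_eq_reduce {p : Γ.V}
    (γ : Quiver.Path (V := Quiver.Symmetrify Γ.V) p p) :
    reducedWord (Γ.homotopyClass p γ) = FreeGroup.reduce (word γ) :=
  (congrArg FreeGroup.toWord (groupValue_wordFunctor γ)).trans FreeGroup.toWord_mk

open Classical in
theorem reducedWord_homotopyClass {p : Γ.V} (γ : Quiver.Path (V := Quiver.Symmetrify Γ.V) p p)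
    (h : List.IsChain Γ.dartGraph.Step (word γ)) :
    reducedWord (Γ.homotopyClass p γ) = word γ := by
  rw [reducedWord_homotopyClass_eq_reduce, (isReduced_of_isChain h).reduce_eq]

theorem exists_reduced_representative {p : Γ.V} (g : Γ.FundGroup p) :
    ∃ γ : Quiver.Path (V := Quiver.Symmetrify Γ.V) p p, Γ.homotopyClass p γ = g ∧
      List.IsChain Γ.dartGraph.Step (word γ) ∧ word γ = reducedWord g := by
  obtain ⟨γ, rfl⟩ : ∃ γ, Γ.homotopyClass p γ = g :=
    (CategoryTheory.Quotient.functor (Quiver.FreeGroupoid.redStep (V := Γ.V))).map_surjective g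
  obtain ⟨δ, hδ, hred⟩ := exists_reduced_path γ
  have hδ' : Γ.homotopyClass p δ = Γ.homotopyClass p γ := hδ
  exact ⟨δ, hδ', hred, by rw [← hδ', reducedWord_homotopyClass δ hred]⟩

/-- The functor to the free group on the edges is faithful on vertex groups. -/
theorem reducedWord_injective (p : Γ.V) :
    Function.Injective (reducedWord : Γ.FundGroup p → List Γ.Dart) := by
  intro g g' h
  obtain ⟨γ, rfl, -, hγ⟩ := exists_reduced_representative g
  obtain ⟨γ', rfl, -, hγ'⟩ := exists_reduced_representative g'
  rw [word_injective γ γ' (hγ.trans (h.trans hγ'.symm))]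

open Classical in
/-- The infimum in the definition of the displacement is attained by the reduced path, since
reduction turns a word into a subword. -/
theorem displacement_eq_wordLen {p : Γ.V} (g : Γ.FundGroup p) :
    Γ.displacement p g = wordLen Γ.dartLen (reducedWord g) := by
  obtain ⟨γ, hg, -, hγ⟩ := exists_reduced_representative g
  refine IsLeast.csInf_eq ⟨⟨γ, hg, ?_⟩, ?_⟩
  · exact (pathLen_eq_wordLen γ).trans (by rw [hγ])
  · rintro _ ⟨δ, rfl, rfl⟩
    rw [reducedWord_homotopyClass_eq_reduce]
    refine le_trans ?_ (pathLen_eq_wordLen δ).ge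
    refine ((FreeGroup.reduce.red (L := word δ)).sublist.map Γ.dartLen).sum_le_sum ?_
    intro x hx
    obtain ⟨d, -, rfl⟩ := List.mem_map.1 hx
    exact (Γ.dartLen_pos d).le

theorem isChain_reducedWord_and_tip_head {p : Γ.V} (g : Γ.FundGroup p) :
    List.IsChain Γ.dartGraph.Step (reducedWord g) ∧
      ∀ e ∈ (reducedWord g).head?, Γ.dartGraph.tip e = p := by
  obtain ⟨γ, -, h, hγ⟩ := exists_reduced_representative g
  rw [← hγ]
  refine ⟨h, ?_⟩
  cases γ with
  | nil => simp [word]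
  | cons γ e =>
    rintro _ ⟨⟩
    exact tip_toDart e

/-- Every non-empty closed edge-path at `p` without backtracking is the reduced word of an element
of the fundamental group. -/
theorem exists_reducedWord_eq {p : Γ.V} (w : WordsBetween Γ.dartGraph.Step
    (fun e => Γ.dartGraph.tip e = p) (fun e => Γ.dartGraph.tip (Γ.dartGraph.rev e) = p)) :
    ∃ g : Γ.FundGroup p, reducedWord g = w.1 := by
  obtain ⟨_ | ⟨e, w⟩, hw, ⟨x, hx, hxp⟩, ⟨y, hy, hyp⟩⟩ := w
  · cases hx
  · cases hx
    obtain ⟨γ, hγ⟩ := exists_path_of_word e w hw p p hxp fun f hf => by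
      rwa [Option.mem_unique hf hy]
    exact ⟨Γ.homotopyClass p γ, by rw [reducedWord_homotopyClass γ (by rwa [hγ]), hγ]⟩

end MetricGraph

/-! ### Entropy and the growth of words -/

namespace MetricGraph

variable (Γ : MetricGraph)

theorem deg_dartGraph (v : Γ.V) : Γ.dartGraph.deg v = Γ.degree v := by
  classical
  rw [DartGraph.deg, Finset.card_filter, Fintype.sum_prod_type, Fintype.sum_sigma]
  simp only [Fintype.sum_sigma, Fintype.sum_bool, dartGraph, if_true, Bool.false_eq_true, if_false,
    Finset.sum_add_distrib, Finset.sum_const, Finset.card_univ, smul_eq_mul, mul_ite, mul_one,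
    mul_zero, Finset.sum_ite_eq', Finset.mem_univ, degree]
  rw [add_comm]
  congr 1
  · exact Fintype.card_sigma
  · refine Finset.sum_congr rfl fun a _ => ?_
    rw [Finset.sum_eq_single v (fun b _ hb => by simp [hb]) (by simp)]
    simp

theorem sum_dartLen : ∑ e, Γ.dartLen e = 2 * Γ.volume := by
  rw [Fintype.sum_prod_type, Fintype.sum_sigma]
  simp only [Fintype.sum_sigma, Fintype.sum_bool, dartLen, ← two_mul, ← Finset.mul_sum, volume]

theorem sum_degree : ∑ v, Γ.degree v = 2 * Fintype.card Γ.Edge := by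
  have h := Γ.dartGraph.sum_tip_rev (fun _ => (1 : ℝ))
  simp only [Finset.sum_const, Finset.card_univ, Fintype.card_prod, Fintype.card_bool,
    nsmul_eq_mul, mul_one, deg_dartGraph] at h
  have h' : Fintype.card Γ.Edge * 2 = ∑ v, Γ.degree v := by exact_mod_cast h
  omega

theorem exists_le_dartLen : ∃ m : ℝ, 0 < m ∧ ∀ e, m ≤ Γ.dartLen e := by
  cases isEmpty_or_nonempty Γ.Dart
  · exact ⟨1, one_pos, fun e => isEmptyElim e⟩
  · obtain ⟨e, he⟩ := Finite.exists_min Γ.dartLen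
    exact ⟨_, Γ.dartLen_pos e, he⟩

open Classical in
/-- Orbit points in a ball correspond to closed words, so the bound on the number of words bounds
their number. -/
theorem exists_card_displacement_le {s θ : ℝ} (hs : 0 ≤ s) (hθ : θ < 1)
    (h : ∀ e, ∑ f with Γ.dartGraph.Step e f, Real.exp (-s * Γ.dartLen f) ≤ θ) (p : Γ.V) :
    ∃ C : ℝ, 0 < C ∧ ∀ R, {g | Γ.displacement p g ≤ R}.Finite ∧
      (0 ≤ R → (Nat.card {g // Γ.displacement p g ≤ R} : ℝ) ≤ C * Real.exp (s * R)) := by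
  obtain ⟨m, hm, hml⟩ := Γ.exists_le_dartLen
  have hθ' : 0 < (1 - θ)⁻¹ := inv_pos.2 (by linarith)
  refine ⟨1 + Fintype.card Γ.Dart * (1 - θ)⁻¹, by positivity, fun R => ?_⟩
  obtain ⟨n, hn⟩ := exists_nat_gt (R / m)
  rw [div_lt_iff₀ hm] at hn
  choose F hF hcard using
    exists_finset_words_card_le Γ.dartGraph.Step Γ.dartLen hm hs hml hθ h n R hn
  let T : Finset (List Γ.Dart) :=
    insert [] (Finset.univ.biUnion fun e : Γ.Dart => (F e).image (List.cons e))
  have hT : Set.MapsTo (reducedWord (p := p)) {g | Γ.displacement p g ≤ R} T := by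
    intro g hg
    rw [Set.mem_ofPred_eq, displacement_eq_wordLen] at hg
    have hc := (isChain_reducedWord_and_tip_head g).1
    rcases hw : reducedWord g with _ | ⟨e, w⟩
    · exact Finset.mem_insert_self _ _
    · rw [hw] at hg hc
      rw [wordLen_cons] at hg
      refine Finset.mem_insert_of_mem (Finset.mem_biUnion.2 ⟨e, Finset.mem_univ _,
        Finset.mem_image_of_mem _ (hF e w hc ?_)⟩)
      linarith [Γ.dartLen_pos e]
  refine ⟨Set.Finite.of_injOn hT (reducedWord_injective p).injOn T.finite_toSet, fun hR => ?_⟩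
  have h1 : Nat.card {g // Γ.displacement p g ≤ R} ≤ T.card := by
    have := Set.ncard_le_ncard_of_injOn _ hT (reducedWord_injective p).injOn T.finite_toSet
    rwa [Set.ncard_coe_finset] at this
  have h2 : (T.card : ℝ) ≤ (∑ e, ((F e).card : ℝ)) + 1 := by
    refine (Nat.cast_le.2 (Finset.card_insert_le _ _)).trans ?_
    push_cast
    gcongr
    refine (Nat.cast_le.2 Finset.card_biUnion_le).trans ?_
    push_cast
    exact Finset.sum_le_sum fun f _ => Nat.cast_le.2 Finset.card_image_le
  have h3 : ∑ e, ((F e).card : ℝ) ≤ Fintype.card Γ.Dart * ((1 - θ)⁻¹ * Real.exp (s * R)) := by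
    refine (Finset.sum_le_sum fun e _ => hcard e).trans ?_
    rw [Finset.sum_const, nsmul_eq_mul, Finset.card_univ]
  have h4 : 1 ≤ Real.exp (s * R) := Real.one_le_exp (by positivity)
  calc (Nat.card {g // Γ.displacement p g ≤ R} : ℝ) ≤ T.card := Nat.cast_le.2 h1
    _ ≤ Fintype.card Γ.Dart * ((1 - θ)⁻¹ * Real.exp (s * R)) + Real.exp (s * R) := by linarith
    _ = _ := by ring

/-- The normalised logarithm of the number of orbit points in a ball. -/
noncomputable def logCount (p : Γ.V) (R : ℝ) : ℝ :=
  Real.log (Nat.card {g : Γ.FundGroup p // Γ.displacement p g ≤ R}) / R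

/-- As `Real.log 0 = 0`, an empty ball would do no harm. -/
theorem logCount_nonneg (p : Γ.V) : ∀ᶠ R in Filter.atTop, 0 ≤ Γ.logCount p R := by
  filter_upwards [Filter.eventually_ge_atTop 0] with R hR
  exact div_nonneg (Real.log_natCast_nonneg _) hR

theorem isCoboundedUnder_logCount (p : Γ.V) :
    Filter.IsCoboundedUnder (· ≤ ·) Filter.atTop (Γ.logCount p) :=
  Filter.isCoboundedUnder_le_of_eventually_le _ (Γ.logCount_nonneg p)

open Classical in
/-- A word bound with exponent `s` bounds the volume entropy by `s`. The boundedness of the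
logarithmic count is needed besides, since the `limsup` of an unbounded function is a junk
value. -/
theorem isBoundedUnder_and_volumeEntropy_le {s θ : ℝ} (hs : 0 ≤ s) (hθ : θ < 1)
    (h : ∀ e, ∑ f with Γ.dartGraph.Step e f, Real.exp (-s * Γ.dartLen f) ≤ θ) (p : Γ.V) :
    Filter.IsBoundedUnder (· ≤ ·) Filter.atTop (Γ.logCount p) ∧ Γ.volumeEntropy p ≤ s := by
  obtain ⟨C, hC, hcard⟩ := Γ.exists_card_displacement_le hs hθ h p
  have hle : ∀ᶠ R in Filter.atTop, Γ.logCount p R ≤ |Real.log C| / R + s := by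
    filter_upwards [Filter.eventually_gt_atTop 0] with R hR
    rw [logCount, div_add' _ _ _ hR.ne']
    refine div_le_div_of_nonneg_right ?_ hR.le
    rcases Nat.eq_zero_or_pos (Nat.card {g // Γ.displacement p g ≤ R}) with h0 | h0
    · rw [h0, Nat.cast_zero, Real.log_zero]
      positivity
    · refine (Real.log_le_log (Nat.cast_pos.2 h0) ((hcard R).2 hR.le)).trans ?_
      rw [Real.log_mul hC.ne' (Real.exp_pos _).ne', Real.log_exp]
      gcongr
      exact le_abs_self _
  have htend : Filter.Tendsto (fun R : ℝ => |Real.log C| / R + s) Filter.atTop (nhds s) := by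
    have := (Filter.Tendsto.div_atTop (tendsto_const_nhds (x := |Real.log C|))
      Filter.tendsto_id).add_const s
    simpa using this
  refine ⟨htend.isBoundedUnder_le.mono_le hle, ?_⟩
  exact (Filter.limsup_le_limsup hle (Γ.isCoboundedUnder_logCount p)
    htend.isBoundedUnder_le).trans htend.limsup_eq.le

open Classical in
theorem volumeEntropy_le {s θ : ℝ} (hs : 0 ≤ s) (hθ : θ < 1)
    (h : ∀ e, ∑ f with Γ.dartGraph.Step e f, Real.exp (-s * Γ.dartLen f) ≤ θ) (p : Γ.V) :
    Γ.volumeEntropy p ≤ s := (Γ.isBoundedUnder_and_volumeEntropy_le hs hθ h p).2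

open Classical in
/-- The hypothesis of the word bound holds for large exponents. -/
theorem exists_sum_exp_le : ∃ s : ℝ, 0 ≤ s ∧
    ∀ e, ∑ f with Γ.dartGraph.Step e f, Real.exp (-s * Γ.dartLen f) ≤ 1 / 2 := by
  obtain ⟨m, hm, hml⟩ := Γ.exists_le_dartLen
  set N : ℝ := (Fintype.card Γ.Dart : ℝ) with hN
  have hN0 : 0 ≤ N := Nat.cast_nonneg _
  refine ⟨2 * N / m, by positivity, fun e => ?_⟩
  calc ∑ f with Γ.dartGraph.Step e f, Real.exp (-(2 * N / m) * Γ.dartLen f)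
      ≤ ∑ f : Γ.Dart, Real.exp (-(2 * N / m) * Γ.dartLen f) :=
        Finset.sum_le_sum_of_subset_of_nonneg (Finset.filter_subset _ _)
          fun _ _ _ => (Real.exp_pos _).le
    _ ≤ ∑ f : Γ.Dart, (2 * N + 1)⁻¹ := by
        refine Finset.sum_le_sum fun f _ => ?_
        rw [neg_mul, Real.exp_neg]
        refine inv_anti₀ (by positivity) ((Real.add_one_le_exp _).trans (Real.exp_le_exp.2 ?_))
        calc 2 * N = 2 * N / m * m := by field_simp
          _ ≤ _ := mul_le_mul_of_nonneg_left (hml f) (by positivity)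
    _ ≤ 1 / 2 := by
        rw [Finset.sum_const, nsmul_eq_mul, Finset.card_univ, ← hN, ← div_eq_mul_inv,
          div_le_div_iff₀ (by positivity) two_pos]
        linarith

theorem isBoundedUnder_logCount (p : Γ.V) :
    Filter.IsBoundedUnder (· ≤ ·) Filter.atTop (Γ.logCount p) := by
  obtain ⟨s, hs, h⟩ := Γ.exists_sum_exp_le
  exact (Γ.isBoundedUnder_and_volumeEntropy_le hs (by norm_num) h p).1

theorem finite_displacement_le (p : Γ.V) (R : ℝ) : {g | Γ.displacement p g ≤ R}.Finite := by
  obtain ⟨s, hs, h⟩ := Γ.exists_sum_exp_le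
  obtain ⟨C, -, hC⟩ := Γ.exists_card_displacement_le hs (by norm_num) h p
  exact (hC R).1

theorem volumeEntropy_nonneg (p : Γ.V) : 0 ≤ Γ.volumeEntropy p :=
  Filter.le_limsup_of_frequently_le (Γ.logCount_nonneg p).frequently (Γ.isBoundedUnder_logCount p)

theorem displacement_nonneg (p : Γ.V) (g : Γ.FundGroup p) : 0 ≤ Γ.displacement p g := by
  rw [displacement_eq_wordLen]
  exact wordLen_nonneg Γ.dartLen_pos _

/-- The Poincaré series of the fundamental group converges above the entropy. -/
theorem poincareSeries_lt_top (p : Γ.V) {s : ℝ} (hs : Γ.volumeEntropy p < s) :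
    ∑' g, ENNReal.ofReal (Real.exp (-s * Γ.displacement p g)) < ⊤ := by
  obtain ⟨t, ht, hts⟩ := exists_between hs
  have ht0 : 0 ≤ t := (Γ.volumeEntropy_nonneg p).trans ht.le
  obtain ⟨R₀, hR₀⟩ := Filter.eventually_atTop.1
    ((Filter.eventually_lt_of_limsup_lt (u := Γ.logCount p) ht
      (Γ.isBoundedUnder_logCount p)).and (Filter.eventually_gt_atTop 0))
  have hcard : ∀ R, R₀ ≤ R → (Nat.card {g // Γ.displacement p g ≤ R} : ℝ) ≤ Real.exp (t * R) := by
    intro R hR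
    obtain ⟨h1, h2⟩ := hR₀ R hR
    rw [logCount, div_lt_iff₀ h2] at h1
    rcases Nat.eq_zero_or_pos (Nat.card {g // Γ.displacement p g ≤ R}) with h0 | h0
    · rw [h0, Nat.cast_zero]
      exact (Real.exp_pos _).le
    · exact (Real.log_le_iff_le_exp (Nat.cast_pos.2 h0)).1 h1.le
  have hmono : ∀ R R', R ≤ R' → Nat.card {g // Γ.displacement p g ≤ R} ≤
      Nat.card {g // Γ.displacement p g ≤ R'} := fun R R' h =>
    Set.ncard_le_ncard (fun g hg => le_trans hg h) (Γ.finite_displacement_le p R')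
  refine tsum_exp_lt_top (Γ.displacement p) (Γ.displacement_nonneg p) (Γ.finite_displacement_le p)
    (C := Real.exp (t * |R₀|)) (t := t) (ht0.trans hts.le) hts fun n => ?_
  refine (Nat.cast_le.2 (hmono n (|R₀| + n) (by linarith [abs_nonneg R₀]))).trans ?_
  rw [← Real.exp_add, ← mul_add]
  exact hcard _ ((le_abs_self _).trans (by simp))

theorem wordsBetween_series_lt_top (p : Γ.V) {s : ℝ} (hs : Γ.volumeEntropy p < s) :
    ∑' w : WordsBetween Γ.dartGraph.Step (fun e => Γ.dartGraph.tip e = p)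
      (fun e => Γ.dartGraph.tip (Γ.dartGraph.rev e) = p),
      ENNReal.ofReal (Real.exp (-s * wordLen Γ.dartLen w.1)) < ⊤ := by
  choose g hg using fun w => exists_reducedWord_eq (p := p) w
  have hinj : Function.Injective g := fun w w' h => Subtype.ext (by rw [← hg, ← hg, h])
  refine lt_of_le_of_lt ?_ (Γ.poincareSeries_lt_top p hs)
  refine le_trans (le_of_eq ?_) (ENNReal.tsum_comp_le_tsum_of_injective hinj _)
  exact tsum_congr fun w => by rw [displacement_eq_wordLen, hg]

theorem reflTransGen_of_path {a b : Quiver.Symmetrify Γ.V} (γ : Quiver.Path a b) :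
    Relation.ReflTransGen (fun u v => ∃ e, Γ.dartGraph.tip e = u ∧
      Γ.dartGraph.tip (Γ.dartGraph.rev e) = v) a b := by
  induction γ with
  | nil => exact Relation.ReflTransGen.refl
  | cons γ e ih =>
    refine ih.tail ⟨Γ.dartGraph.rev (Γ.toDart e), tip_rev_toDart e, ?_⟩
    rw [Γ.dartGraph.rev_rev, tip_toDart]

/-- The lower bound for the entropy of a metric graph in terms of the degrees, and a consequence
of equality. -/
theorem sum_degree_mul_log_le (hΓ : Γ.IsConnected) (hdeg : ∀ v, 3 ≤ Γ.degree v) (p : Γ.V) :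
    ∑ v, (Γ.degree v : ℝ) * Real.log (Γ.degree v - 1) ≤ 2 * Γ.volumeEntropy p * Γ.volume ∧
    (∑ v, (Γ.degree v : ℝ) * Real.log (Γ.degree v - 1) = 2 * Γ.volumeEntropy p * Γ.volume →
      Γ.IsTrivalent → ∀ e, Γ.volumeEntropy p * Γ.dartLen e = Real.log 2) := by
  have hd : ∀ v, 3 ≤ Γ.dartGraph.deg v := fun v => (hdeg v).trans_eq (Γ.deg_dartGraph v).symm
  have hr := Γ.dartGraph.reflTransGen_step hd fun u v => Γ.reflTransGen_of_path (hΓ.2 u v).some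
  obtain ⟨a, ha⟩ := Γ.dartGraph.exists_tip_eq hd p
  have : Nonempty Γ.Dart := ⟨a⟩
  obtain ⟨x, hx, hsup⟩ := exists_pos_supersolution Γ.dartGraph.Step hr Γ.dartLen
    (h := Γ.volumeEntropy p) fun s hs e =>
      wordSeries_lt_top Γ.dartGraph.Step hr Γ.dartLen ((Γ.volumeEntropy_nonneg p).trans hs.le)
        _ _ ha (b := Γ.dartGraph.rev a) (by rw [Γ.dartGraph.rev_rev]; exact ha)
        (Γ.wordsBetween_series_lt_top p hs) e
  have h1 := Γ.dartGraph.entropy_inequality hd Γ.dartLen x hx hsup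
  rw [Γ.dartGraph.sum_tip_rev fun v => Real.log (Γ.dartGraph.branching v), sum_dartLen] at h1
  simp only [DartGraph.branching, deg_dartGraph] at h1
  have h2 : Γ.volumeEntropy p * (2 * Γ.volume) = 2 * Γ.volumeEntropy p * Γ.volume := by ring
  rw [h2] at h1
  refine ⟨h1.1, fun heq htri e => ?_⟩
  refine Γ.dartGraph.mul_length_eq_log_two (fun v => (Γ.deg_dartGraph v).trans (htri v))
    Γ.dartLen x (fun _ => rfl) hx ?_ e
  simp only [DartGraph.branching, deg_dartGraph]
  exact h1.2 heq

end MetricGraph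

/-! ### Comparison of the degrees with the rank -/

/-- Degree three minimises `d * log (d - 1) / (d - 2)`. -/
theorem three_mul_log_two_le {d : ℕ} (hd : 3 ≤ d) :
    3 * ((d : ℝ) - 2) * Real.log 2 ≤ d * Real.log (d - 1) ∧
      (3 * ((d : ℝ) - 2) * Real.log 2 = d * Real.log (d - 1) → d = 3) := by
  rcases hd.eq_or_lt with rfl | hd
  · norm_num
  suffices h : 3 * ((d : ℝ) - 2) * Real.log 2 < d * Real.log (d - 1) from
    ⟨h.le, fun h' => absurd h' h.ne⟩
  obtain ⟨n, rfl⟩ : ∃ n, d = n + 2 := ⟨d - 2, by omega⟩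
  have hpow : 2 ^ (3 * n) < (n + 1) ^ (n + 2) := by
    rcases lt_or_ge n 7 with h | h
    · interval_cases n <;> omega
    · calc 2 ^ (3 * n) = 8 ^ n := by rw [pow_mul]; norm_num
        _ < 8 ^ (n + 2) := Nat.pow_lt_pow_right (by norm_num) (by omega)
        _ ≤ (n + 1) ^ (n + 2) := Nat.pow_le_pow_left (by omega) _
  have hlog := Real.log_lt_log (by positivity) (show (2 : ℝ) ^ (3 * n) < (n + 1) ^ (n + 2) by
    exact_mod_cast hpow)
  rw [Real.log_pow, Real.log_pow] at hlog
  push_cast at hlog ⊢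
  rw [show (n : ℝ) + 2 - 1 = n + 1 by ring, show (n : ℝ) + 2 - 2 = n by ring]
  exact hlog

namespace MetricGraph

variable {Γ : MetricGraph}

/-- An isolated vertex would be the whole graph, whose volume would then be zero. -/
theorem InModuli.three_le_degree {k : ℕ} (hΓ : Γ.InModuli k) (v : Γ.V) : 3 ≤ Γ.degree v := by
  have h1 := hΓ.degree_ne_one v
  have h2 := hΓ.degree_ne_two v
  suffices Γ.degree v ≠ 0 by omega
  intro h0
  have hnone : ∀ e : Γ.Dart, Γ.dartGraph.tip e ≠ v := by
    intro e he
    rw [← deg_dartGraph, DartGraph.deg, Finset.card_eq_zero] at h0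
    simpa [he] using Finset.eq_empty_iff_forall_notMem.1 h0 e
  have hall : ∀ u, u = v := by
    intro u
    have := Γ.reflTransGen_of_path (hΓ.connected.2 v u).some
    rcases Relation.ReflTransGen.cases_head this with h | ⟨w, ⟨e, he, -⟩, -⟩
    · exact h.symm
    · exact absurd he (hnone e)
  have hvol := hΓ.volume_eq_one
  have hempty : IsEmpty Γ.Dart := ⟨fun e => hnone e (hall _)⟩
  have := Γ.sum_dartLen
  rw [Fintype.sum_empty, hvol] at this
  norm_num at this

theorem InModuli.sum_degree_sub_two {k : ℕ} (hΓ : Γ.InModuli k) :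
    ∑ v, ((Γ.degree v : ℝ) - 2) = 2 * (k : ℝ) - 2 := by
  have h1 : ((∑ v, Γ.degree v : ℕ) : ℝ) = (2 * Fintype.card Γ.Edge : ℕ) := by rw [sum_degree]
  have h2 : ((Fintype.card Γ.Edge + 1 : ℕ) : ℝ) = (Fintype.card Γ.V + k : ℕ) := by
    rw [Γ.card_edge_add_one hΓ]
  push_cast at h1 h2
  rw [Finset.sum_sub_distrib, h1, Finset.sum_const, nsmul_eq_mul, Finset.card_univ]
  linarith

theorem InModuli.le_sum_degree_mul_log {k : ℕ} (hΓ : Γ.InModuli k) :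
    2 * ((3 * (k : ℝ) - 3) * Real.log 2) ≤
      ∑ v, (Γ.degree v : ℝ) * Real.log (Γ.degree v - 1) ∧
    (2 * ((3 * (k : ℝ) - 3) * Real.log 2) =
      ∑ v, (Γ.degree v : ℝ) * Real.log (Γ.degree v - 1) → Γ.IsTrivalent) := by
  have h1 : 2 * ((3 * (k : ℝ) - 3) * Real.log 2) =
      ∑ v, 3 * ((Γ.degree v : ℝ) - 2) * Real.log 2 := by
    rw [← Finset.sum_mul, ← Finset.mul_sum, hΓ.sum_degree_sub_two]
    ring
  have h2 := fun v => three_mul_log_two_le (hΓ.three_le_degree v)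
  rw [h1]
  refine ⟨Finset.sum_le_sum fun v _ => (h2 v).1, fun heq v => (h2 v).2 ?_⟩
  exact (Finset.sum_eq_sum_iff_of_le fun v _ => (h2 v).1).1 heq v (Finset.mem_univ v)

theorem InModuli.le_volumeEntropy {k : ℕ} (hΓ : Γ.InModuli k) (p : Γ.V) :
    (3 * (k : ℝ) - 3) * Real.log 2 ≤ Γ.volumeEntropy p := by
  have h1 := (Γ.sum_degree_mul_log_le hΓ.connected hΓ.three_le_degree p).1
  rw [hΓ.volume_eq_one] at h1
  linarith [hΓ.le_sum_degree_mul_log.1]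

theorem InModuli.rigidity {k : ℕ} (hΓ : Γ.InModuli k) (p : Γ.V)
    (h : Γ.volumeEntropy p = (3 * (k : ℝ) - 3) * Real.log 2) :
    Γ.IsTrivalent ∧ Γ.IsEquilateral := by
  obtain ⟨h1, h2⟩ := Γ.sum_degree_mul_log_le hΓ.connected hΓ.three_le_degree p
  rw [hΓ.volume_eq_one] at h1 h2
  obtain ⟨h3, h4⟩ := hΓ.le_sum_degree_mul_log
  have htri : Γ.IsTrivalent := h4 (by linarith)
  have hlen := h2 (by linarith) htri
  refine ⟨htri, fun a b c d e f => ?_⟩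
  have he : Γ.volumeEntropy p * Γ.len e = Real.log 2 := hlen (⟨a, b, e⟩, true)
  have hf : Γ.volumeEntropy p * Γ.len f = Real.log 2 := hlen (⟨c, d, f⟩, true)
  have h0 : Γ.volumeEntropy p ≠ 0 := by
    intro h0
    rw [h0, zero_mul] at he
    exact (Real.log_pos one_lt_two).ne he
  exact mul_left_cancel₀ h0 (he.trans hf.symm)

theorem volume_eq_card_mul {c : ℝ} (h : ∀ (a b : Γ.V) (e : a ⟶ b), Γ.len e = c) :
    Γ.volume = Fintype.card Γ.Edge * c := by
  have h1 := Γ.sum_dartLen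
  have h2 : ∀ e, Γ.dartLen e = c := fun e => h _ _ _
  simp only [h2, Finset.sum_const, Finset.card_univ, nsmul_eq_mul, Fintype.card_prod,
    Fintype.card_bool] at h1
  push_cast at h1
  linarith

/-- On a trivalent graph with all lengths equal to `c`, every dart has two successors, and
`2 * exp (-s * c) < 1` as soon as `s` exceeds `log 2 / c`. -/
theorem InModuli.volumeEntropy_eq {k : ℕ} (hΓ : Γ.InModuli k) (htri : Γ.IsTrivalent)
    (heq : Γ.IsEquilateral) (p : Γ.V) :
    Γ.volumeEntropy p = (3 * (k : ℝ) - 3) * Real.log 2 := by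
  classical
  refine le_antisymm ?_ (hΓ.le_volumeEntropy p)
  have hd : ∀ v, Γ.dartGraph.deg v = 3 := fun v => (Γ.deg_dartGraph v).trans (htri v)
  obtain ⟨⟨⟨a, b, e⟩, -⟩, -⟩ := Γ.dartGraph.exists_tip_eq (fun v => (hd v).ge) p
  set c := Γ.len e with hc
  have hc0 : 0 < c := Γ.len_pos e
  have hlen : ∀ (a b : Γ.V) (e : a ⟶ b), Γ.len e = c := fun a' b' e' => heq _ _ _ _ e' e
  have hvol := volume_eq_card_mul hlen
  rw [hΓ.volume_eq_one] at hvol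
  have hE : (Fintype.card Γ.Edge : ℝ) = 3 * (k : ℝ) - 3 := by
    have h1 := Γ.sum_degree
    have h2 : ∀ v, Γ.degree v = 3 := htri
    simp only [h2, Finset.sum_const, Finset.card_univ, smul_eq_mul] at h1
    have h3 := Γ.card_edge_add_one hΓ
    have h4 : Fintype.card Γ.Edge + 3 = 3 * k := by omega
    have h5 : (Fintype.card Γ.Edge : ℝ) + 3 = 3 * k := by exact_mod_cast h4
    linarith
  rw [← hE]
  refine le_of_forall_gt_imp_ge_of_dense fun s hs => ?_
  have hsc : Real.log 2 < s * c := by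
    calc Real.log 2 = Fintype.card Γ.Edge * Real.log 2 * c := by
          rw [mul_right_comm, ← hvol, one_mul]
      _ < s * c := mul_lt_mul_of_pos_right hs hc0
  have hs0 : 0 ≤ s := le_trans (mul_nonneg (Nat.cast_nonneg _) (Real.log_pos one_lt_two).le) hs.le
  refine Γ.volumeEntropy_le (θ := 2 * Real.exp (-s * c)) hs0 ?_ (fun e => ?_) p
  · have : Real.exp (-s * c) < 1 / 2 := by
      rw [neg_mul, Real.exp_neg, ← one_div]
      refine one_div_lt_one_div_of_lt two_pos ?_
      rwa [← Real.log_lt_iff_lt_exp two_pos]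
    linarith
  · have h2 : ∀ e, Γ.dartLen e = c := fun e => hlen _ _ _
    simp only [h2]
    rw [Finset.sum_const, nsmul_eq_mul]
    have := Γ.dartGraph.card_successors e
    rw [DartGraph.branching, hd] at this
    rw [this]
    norm_num

/-! ### A trivalent graph of every rank -/

/-- The initial vertex of an edge of a necklace: `(i, 0)` and `(i, 1)` join `(i, false)` to
`(i, true)`, and `(i, 2)` joins `(i, true)` to `(i + 1, false)`. -/
def necklaceSrc {m : ℕ} (e : Fin (m + 1) × Fin 3) : Fin (m + 1) × Bool := (e.1, e.2 = 2)

/-- The terminal vertex of an edge of a necklace. -/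
def necklaceTgt {m : ℕ} (e : Fin (m + 1) × Fin 3) : Fin (m + 1) × Bool :=
  if e.2 = 2 then (e.1 + 1, false) else (e.1, true)

/-- The necklace with `m + 1` double edges that are cyclically joined by `m + 1` single edges, all
of the same length. -/
noncomputable def necklace (m : ℕ) : MetricGraph where
  V := Fin (m + 1) × Bool
  quiver := ⟨fun a b => {e : Fin (m + 1) × Fin 3 // necklaceSrc e = a ∧ necklaceTgt e = b}⟩
  fintypeEdge a b := inferInstanceAs
    (Fintype {e : Fin (m + 1) × Fin 3 // necklaceSrc e = a ∧ necklaceTgt e = b})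
  len _ := (3 * ((m : ℝ) + 1))⁻¹
  len_pos _ := by positivity

theorem isTrivalent_necklace (m : ℕ) : (necklace m).IsTrivalent := by
  classical
  have hcard : ∀ (a b : Fin (m + 1) × Bool), @Fintype.card _ ((necklace m).fintypeEdge a b) =
      ∑ e : Fin (m + 1) × Fin 3, if necklaceSrc e = a ∧ necklaceTgt e = b then 1 else 0 := by
    intro a b
    rw [← Finset.card_filter, ← Fintype.card_subtype]
    -- The arrows of `necklace m` carry this subtype by definition.
    exact @Fintype.card_congr _ _ ((necklace m).fintypeEdge a b) _ (Equiv.refl _)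
  have h1 : ∀ v : Fin (m + 1) × Bool, ∑ w, @Fintype.card _ ((necklace m).fintypeEdge v w) =
      ∑ e : Fin (m + 1) × Fin 3, if necklaceSrc e = v then 1 else 0 := by
    intro v
    calc _ = ∑ w : Fin (m + 1) × Bool, ∑ e : Fin (m + 1) × Fin 3,
          if necklaceSrc e = v ∧ necklaceTgt e = w then 1 else 0 :=
          Finset.sum_congr rfl fun w _ => hcard v w
      _ = _ := by
          rw [Finset.sum_comm]
          simp [ite_and]
  have h2 : ∀ v : Fin (m + 1) × Bool, ∑ w, @Fintype.card _ ((necklace m).fintypeEdge w v) =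
      ∑ e : Fin (m + 1) × Fin 3, if necklaceTgt e = v then 1 else 0 := by
    intro v
    calc _ = ∑ w : Fin (m + 1) × Bool, ∑ e : Fin (m + 1) × Fin 3,
          if necklaceSrc e = w ∧ necklaceTgt e = v then 1 else 0 :=
          Finset.sum_congr rfl fun w _ => hcard w v
      _ = _ := by
          rw [Finset.sum_comm]
          simp [ite_and]
  rintro ⟨i, b⟩
  refine (congrArg₂ (· + ·) (h1 (i, b)) (h2 (i, b))).trans ?_
  have hsub : ∀ x : Fin (m + 1), x + 1 = i ↔ x = i - 1 := fun x => eq_sub_iff_add_eq.symm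
  rw [Fintype.sum_prod_type, Fintype.sum_prod_type]
  simp only [Fin.sum_univ_three]
  cases b <;> simp [necklaceSrc, necklaceTgt, Finset.sum_add_distrib, hsub]

theorem isConnected_necklace (m : ℕ) : (necklace m).IsConnected := by
  refine ⟨⟨((0, false) : Fin (m + 1) × Bool)⟩, ?_⟩
  let W := Quiver.Symmetrify (necklace m).V
  let vtx : Fin (m + 1) → Bool → W := fun i b => (i, b)
  have edge1 : ∀ i, Nonempty (Quiver.Path (vtx i false) (vtx i true)) := fun i =>
    ⟨Quiver.Hom.toPath (Sum.inl ⟨((i, 0) : Fin (m + 1) × Fin 3), rfl, rfl⟩)⟩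
  have edge2 : ∀ i, Nonempty (Quiver.Path (vtx i true) (vtx (i + 1) false)) := fun i =>
    ⟨Quiver.Hom.toPath (Sum.inl ⟨((i, 2) : Fin (m + 1) × Fin 3), rfl, rfl⟩)⟩
  have h1 : ∀ i, Nonempty (Quiver.Path (vtx 0 false) (vtx i false)) := by
    intro i
    induction i using Fin.induction with
    | zero => exact ⟨.nil⟩
    | succ i ih =>
      obtain ⟨γ⟩ := ih
      obtain ⟨δ⟩ := edge1 i.castSucc
      obtain ⟨η⟩ := edge2 i.castSucc
      rw [Fin.coeSucc_eq_succ] at η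
      exact ⟨(γ.comp δ).comp η⟩
  have h2 : ∀ v : W, Nonempty (Quiver.Path (vtx 0 false) v) := by
    rintro ⟨i, _ | _⟩
    · exact h1 i
    · obtain ⟨γ⟩ := h1 i
      obtain ⟨δ⟩ := edge1 i
      exact ⟨γ.comp δ⟩
  intro a b
  obtain ⟨γ⟩ := h2 a
  obtain ⟨δ⟩ := h2 b
  exact ⟨γ.reverse.comp δ⟩

theorem isEquilateral_necklace (m : ℕ) : (necklace m).IsEquilateral := fun _ _ _ _ _ _ => rfl

theorem inModuli_necklace (m : ℕ) : (necklace m).InModuli (m + 2) := by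
  have hV : Fintype.card (necklace m).V = (m + 1) * 2 := by
    refine (Fintype.card_congr (Equiv.refl (Fin (m + 1) × Bool))).trans ?_
    simp
  have hE : Fintype.card (necklace m).Edge = 3 * (m + 1) := by
    have h := (necklace m).sum_degree
    rw [Finset.sum_congr rfl fun v _ => isTrivalent_necklace m v, Finset.sum_const,
      Finset.card_univ, hV, smul_eq_mul] at h
    omega
  refine ⟨isConnected_necklace m, fun v => ?_, fun v => ?_, fun p => ?_, ?_⟩
  · rw [isTrivalent_necklace m v]
    norm_num
  · rw [isTrivalent_necklace m v]
    norm_num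
  · obtain ⟨k, hk, hcard⟩ := (necklace m).exists_fundGroup_equiv (isConnected_necklace m) p
    obtain rfl : k = m + 2 := by omega
    exact hk
  · rw [volume_eq_card_mul (c := (3 * ((m : ℝ) + 1))⁻¹) fun _ _ _ => rfl, hE]
    push_cast
    field_simp

end MetricGraph

theorem theorem9p5 (k : ℕ) (hk : 1 ≤ k) :
    (∀ Γ : MetricGraph, Γ.InModuli k → ∀ p : Γ.V,
      Γ.volumeEntropy p = (3 * (k : ℝ) - 3) * Real.log 2 →
        Γ.IsTrivalent ∧ Γ.IsEquilateral) ∧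
    (2 ≤ k →
      IsLeast {h : ℝ | ∃ (Γ : MetricGraph) (p : Γ.V), Γ.InModuli k ∧ Γ.volumeEntropy p = h}
        ((3 * (k : ℝ) - 3) * Real.log 2) ∧
      ∀ Γ : MetricGraph, Γ.InModuli k → ∀ p : Γ.V,
        ((∀ Γ' : MetricGraph, Γ'.InModuli k → ∀ p' : Γ'.V,
            Γ.volumeEntropy p ≤ Γ'.volumeEntropy p') ↔
          Γ.IsTrivalent ∧ Γ.IsEquilateral)) := by
  refine ⟨fun Γ hΓ p h => hΓ.rigidity p h, fun hk2 => ?_⟩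
  obtain ⟨m, rfl⟩ : ∃ m, k = m + 2 := ⟨k - 2, by omega⟩
  have hN := MetricGraph.inModuli_necklace m
  obtain ⟨q⟩ := hN.connected.1
  have hq := hN.volumeEntropy_eq (MetricGraph.isTrivalent_necklace m)
    (MetricGraph.isEquilateral_necklace m) q
  refine ⟨⟨⟨_, q, hN, hq⟩, ?_⟩, fun Γ hΓ p => ⟨fun hmin => hΓ.rigidity p ?_, fun h Γ' hΓ' p' => ?_⟩⟩
  · rintro _ ⟨Γ, p, hΓ, rfl⟩
    exact hΓ.le_volumeEntropy p
  · exact le_antisymm ((hmin _ hN q).trans_eq hq) (hΓ.le_volumeEntropy p)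
  · rw [hΓ.volumeEntropy_eq h.1 h.2 p]
    exact hΓ'.le_volumeEntropy p'
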